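/- Setting. Let $\mathcal A$ be a complex associative algebra (not necessarily unital), $\varphi:\mathcal A\to\mathbb C$ a linear functional (no normalisation is needed; in the unital case one usually assumes $\varphi(1)=1$), and $(\mathcal A_\ell,\mathcal A_r)$ a pair of subalgebras. For $i\ge 1$ let $\mathcal A^{(i)}=\mathcal A_\ell\sqcup\mathcal A_r$ be copies of the free product without identification of units, with the functional $\varphi^{(i)}$ induced by $\varphi$; let $\widetilde{\mathcal A}=\sqcup_{i\ge1}\mathcal A^{(i)}$ and let $\widetilde\varphi$ be the bi-monotonic product of the $\varphi^{(i)}$. That is, the unital extension $\Phi$ of $\widetilde\varphi$ to the unitization of $\widetilde{\mathcal A}$ restricts to the unital extension of $\varphi^{(i)}$ on each copy, and for every $m$ there is a functional $\Psi$ which is the delta functional on the unital algebra generated by the copies with index $<m$, equals $\Phi$ on the unital algebra generated by the $m$-th copy, and is such that the pair (unital left algebra, unital right algebra) generated by the copies with index $<m$ and the $m$-th unitized pair are conditionally bi-free with respect to $(\Phi,\Psi)$. Here a family of pairs of unital algebras $(\mathcal B_{k,\ell},\mathcal B_{k,r})$ is conditionally bi-free with respect to $(\Phi,\Psi)$ if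 for all $n\ge1$, $\chi:\{1,\dots,n\}\to\{\ell,r\}$, all $\omega$, and all $b_j\in\mathcal B_{\omega(j),\chi(j)}$ such that $\Psi(b_V)=0$ for every $V\in\pi_{\chi,\omega}$, one has $\Psi(b_1\cdots b_n)=0$ and $\Phi(b_1\cdots b_n)=\prod_{V\in\pi_{\chi,\omega}}\Phi(b_V)$. The order $\prec_\chi$ lists the left positions increasingly and then the right positions decreasingly, $\pi_{\chi,\omega}$ is the partition of $\{1,\dots,n\}$ into the maximal $\prec_\chi$-intervals on which $\omega$ is constant, and $b_V=b_{v_1}\cdots b_{v_s}$ for $V=\{v_1<\dots<v_s\}$. For $a\in\mathcal A_\ell$ or $a\in\mathcal A_r$ put $N.a=a^{(1)}+\dots+a^{(N)}\in\widetilde{\mathcal A}$, and write $\varphi(N.a_1\cdots N.a_n)$ for $\widetilde\varphi(N.a_1\cdots N.a_n)$. Cumulants. Bi-monotonic cumulants with respect to $(\mathcal A_\ell,\mathcal A_r,\varphi)$ are functionals $K_\chi:\mathcal A_{\chi(1)}\times\cdots\times\mathcal A_{\chi(n)}\to\mathbb C$ ($n\ge1$, $\chi:\{1,\dots,n\}\to\{\ell,r\}$)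 such that (1) each $K_\chi$ is multilinear; (2) there are polynomials $Q_\chi$ with $\varphi(a_1\cdots a_n)=K_\chi(a_1,\dots,a_n)+Q_\chi(\{K_{\chi|_V}((a_1,\dots,a_n)|_V)\mid\emptyset\ne V\subsetneq\{1,\dots,n\}\})$; (3) $K_\chi(N.a_1,\dots,N.a_n)=N\,K_\chi(a_1,\dots,a_n)$ for all $N\ge1$, where on the left $K_\chi$ denotes the functionals on the pair of subalgebras of $(\widetilde{\mathcal A},\widetilde\varphi)$ generated by all left, respectively all right, copies, which satisfy (1), and satisfy (2) with the same polynomials $Q_\chi$. Theorem. There are polynomials $P_\chi$ without constant term in $N$, and polynomials $Q_\chi$, depending only on $\chi$ (and not on $\mathcal A,\mathcal A_\ell,\mathcal A_r,\varphi$), such that for every $(\mathcal A,\mathcal A_\ell,\mathcal A_r,\varphi)$ as above the functional $\widetilde\varphi$ exists and is unique, and: (a) for all $n\ge1$, $\chi$, $a_j\in\mathcal A_{\chi(j)}$ and $N\ge1$, $$\varphi(N.a_1\cdots N.a_n)=N\,\varphi(a_1\cdots a_n)+P_\chi\bigl(N,\{\varphi(a_V)\mid\emptyset\ne V\subsetneq\{1,\dots,n\}\}\bigr),$$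 so that this moment is a polynomial in $N$ and in the moments $\varphi(a_V)$, $\emptyset\neq V\subseteq\{1,\dots,n\}$, without constant term in $N$; (b) the coefficients $K_\chi(a_1,\dots,a_n)$ of $N$ in these polynomials form a family of bi-monotonic cumulants with respect to $(\mathcal A_\ell,\mathcal A_r,\varphi)$, with the polynomials $Q_\chi$; in particular bi-monotonic cumulants exist; (c) bi-monotonic cumulants are unique: any family satisfying (1)-(3), with any polynomials, equals the family in (b). -/

import Mathlib

universe u

noncomputable section

namespace BiMonotonic

/-! ### Combinatorics of left and right positions -/

/-- The two faces. -/
inductive Side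
  | left
  | right
  deriving DecidableEq

/-- The (reflexive) total order of positions associated with `χ`: the left positions in increasing
order, followed by the right positions in decreasing order. -/
def chiLE {n : ℕ} (χ : Fin n → Side) (i j : Fin n) : Prop :=
  match χ i, χ j with
  | Side.left, Side.left => i ≤ j
  | Side.left, Side.right => True
  | Side.right, Side.left => False
  | Side.right, Side.right => j ≤ i

instance {n : ℕ} (χ : Fin n → Side) (i j : Fin n) : Decidable (chiLE χ i j) := by
  unfold chiLE
  split <;> infer_instance

/-- `k` lies weakly between `i` and `j` for the order of `χ`. -/
def chiBetween {n : ℕ} (χ : Fin n → Side) (i j k : Fin n) : Prop :=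
  (chiLE χ i k ∧ chiLE χ k j) ∨ (chiLE χ j k ∧ chiLE χ k i)

instance {n : ℕ} (χ : Fin n → Side) (i j k : Fin n) : Decidable (chiBetween χ i j k) := by
  unfold chiBetween
  infer_instance

/-- The maximal `χ`-interval containing `j` on which `ω` is constant. -/
def chiBlock {n : ℕ} {κ : Type*} [DecidableEq κ] (χ : Fin n → Side) (ω : Fin n → κ) (j : Fin n) :
    Finset (Fin n) :=
  Finset.univ.filter fun i => ∀ k, chiBetween χ i j k → ω k = ω j

/-- The partition `π_{χ, ω}` of the positions into the maximal `χ`-intervals on which `ω` is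
constant. -/
def chiPartition {n : ℕ} {κ : Type*} [DecidableEq κ] (χ : Fin n → Side) (ω : Fin n → κ) :
    Finset (Finset (Fin n)) :=
  Finset.univ.image (chiBlock χ ω)

/-- The restriction `χ|_V`, with the elements of `V` renumbered increasingly. -/
def restrictSide {n : ℕ} (χ : Fin n → Side) (V : Finset (Fin n)) : Fin V.card → Side :=
  fun j => χ (V.orderEmbOfFin rfl j)

/-- The restriction `(a₁, …, aₙ)|_V` of a tuple, with the elements of `V` in increasing order. -/
def restrictTuple {n : ℕ} {X : Side → Type*} {χ : Fin n → Side} (a : ∀ j, X (χ j))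
    (V : Finset (Fin n)) : ∀ j : Fin V.card, X (restrictSide χ V j) :=
  fun j => a (V.orderEmbOfFin rfl j)

/-- The nonempty proper subsets of the set of positions. -/
abbrev ProperSub (n : ℕ) : Type := {V : Finset (Fin n) // V.Nonempty ∧ V ≠ Finset.univ}

/-! ### Conditional bi-freeness and bi-monotonic independence of two pairs -/

section Independence

variable {B : Type*} [Ring B] [Algebra ℂ B]

/-- The product `a_V = a_{v₁} ⋯ a_{vₛ}` for `V = {v₁ < ⋯ < vₛ}`. -/
def blockProd {n : ℕ} (a : Fin n → B) (V : Finset (Fin n)) : B :=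
  (List.ofFn fun j => a (V.orderEmbOfFin rfl j)).prod

/-- Conditional bi-freeness of a family of pairs of unital subalgebras with respect to `(Φ, Ψ)`:
if `Ψ(a_V) = 0` for all blocks `V` of `π_{χ, ω}`, then `Ψ(a₁ ⋯ aₙ) = 0` and
`Φ(a₁ ⋯ aₙ) = ∏_V Φ(a_V)`. -/
def IsCBiFree {κ : Type*} [DecidableEq κ] (T : κ → Side → Subalgebra ℂ B) (Φ Ψ : B →ₗ[ℂ] ℂ) :
    Prop :=
  ∀ (n : ℕ), 1 ≤ n → ∀ (χ : Fin n → Side) (ω : Fin n → κ) (a : Fin n → B),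
    (∀ j, a j ∈ T (ω j) (χ j)) →
    (∀ V ∈ chiPartition χ ω, Ψ (blockProd a V) = 0) →
      Ψ (List.ofFn a).prod = 0 ∧
        Φ (List.ofFn a).prod = ∏ V ∈ chiPartition χ ω, Φ (blockProd a V)

/-- Bi-monotonic independence with respect to `Φ`, in this order, of two pairs `T₁`, `T₂` of
unital subalgebras of a unitization `B` with delta functional `δ`: the pairs are conditionally
bi-free with respect to `(Φ, Ψ)`, where `Ψ` is the delta functional on the first pair and `Φ` on
the second one. -/
def IsBiMonotonicPair (δ : B →ₐ[ℂ] ℂ) (Φ : B →ₗ[ℂ] ℂ) (T₁ T₂ : Side → Subalgebra ℂ B) : Prop :=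
  ∃ Ψ : B →ₗ[ℂ] ℂ,
    (∀ x ∈ T₁ Side.left ⊔ T₁ Side.right, Ψ x = δ x) ∧
    (∀ x ∈ T₂ Side.left ⊔ T₂ Side.right, Ψ x = Φ x) ∧
    IsCBiFree ![T₁, T₂] Φ Ψ

end Independence

/-! ### Moments and the dot operation -/

section Dot

variable {A : Type u} [NonUnitalRing A] [Module ℂ A] [IsScalarTower ℂ A A] [SMulCommClass ℂ A A]

/-- The unital linear extension of `φ` to the unitization. -/
def extend (φ : A →ₗ[ℂ] ℂ) : Unitization ℂ A →ₗ[ℂ] ℂ :=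
  (Unitization.fstHom ℂ A).toLinearMap + φ ∘ₗ Unitization.sndHom ℂ ℂ A

/-- The moment `φ(a₁ ⋯ aₙ)`. The product is taken in the unitization because `A` need not have a
unit; for `n = 0` the value is `1`. -/
def moment (φ : A →ₗ[ℂ] ℂ) {n : ℕ} (a : Fin n → A) : ℂ :=
  extend φ (List.ofFn fun j => (Unitization.inr (a j) : Unitization ℂ A)).prod

/-- The unital free product of the unitizations of the copies `A_ℓ⁽ⁱ⁾`, `A_r⁽ⁱ⁾`, `i ∈ ℕ`, of the
two subalgebras, that is, the unitization of `⊔ᵢ (A_ℓ⁽ⁱ⁾ ⊔ A_r⁽ⁱ⁾)`. -/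
def DotAlg (S : Side → NonUnitalSubalgebra ℂ A) : Type u :=
  LinearAlgebra.FreeProduct ℂ (fun p : ℕ × Side => Unitization ℂ (S p.2))

variable (S : Side → NonUnitalSubalgebra ℂ A)

instance : Ring (DotAlg S) :=
  inferInstanceAs
    (Ring (LinearAlgebra.FreeProduct ℂ (fun p : ℕ × Side => Unitization ℂ (S p.2))))

instance : Algebra ℂ (DotAlg S) :=
  inferInstanceAs
    (Algebra ℂ (LinearAlgebra.FreeProduct ℂ (fun p : ℕ × Side => Unitization ℂ (S p.2))))

/-- The element `a⁽ⁱ⁾` of the `i`-th copy corresponding to `a`. -/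
def copy (i : ℕ) (s : Side) (a : S s) : DotAlg S :=
  LinearAlgebra.FreeProduct.ι ℂ (fun p : ℕ × Side => Unitization ℂ (S p.2)) (i, s)
    (Unitization.inr a)

/-- The delta functional on the unitization `DotAlg S`. -/
def delta : DotAlg S →ₐ[ℂ] ℂ :=
  LinearAlgebra.FreeProduct.lift ℂ (fun p : ℕ × Side => Unitization ℂ (S p.2))
    (fun {p} => Unitization.fstHom ℂ (S p.2))

/-- The unital subalgebra generated by the copies of side `s` with index in `I`. -/
def copies (I : Set ℕ) (s : Side) : Subalgebra ℂ (DotAlg S) :=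
  Algebra.adjoin ℂ {x | ∃ i ∈ I, ∃ a : S s, x = copy S i s a}

/-- `Φ` is the unital extension of the bi-monotonic product of copies of `φ` restricted to
`A_ℓ ⊔ A_r`: it restricts to `φ` on each copy, and for every `m` the pair generated by the copies
of index `< m` and the `m`-th pair are bi-monotonically independent in this order. -/
structure IsBiMonotonicProduct (φ : A →ₗ[ℂ] ℂ) (Φ : DotAlg S →ₗ[ℂ] ℂ) : Prop where
  map_one : Φ 1 = 1
  restrict : ∀ (i n : ℕ) (χ : Fin n → Side) (a : ∀ j, S (χ j)),
    Φ (List.ofFn fun j => copy S i (χ j) (a j)).prod = moment φ fun j => (a j : A)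
  indep : ∀ m : ℕ, IsBiMonotonicPair (delta S) Φ (copies S (Set.Iio m)) (copies S {m})

/-- The (non-unital) subalgebras of the enlarged space generated by all copies of a given side. -/
def dotSide (s : Side) : NonUnitalSubalgebra ℂ (DotAlg S) :=
  NonUnitalAlgebra.adjoin ℂ {x | ∃ (i : ℕ) (a : S s), x = copy S i s a}

/-- The dot operation `N.a = a⁽¹⁾ + ⋯ + a⁽ᴺ⁾` (the copies being indexed by `0, …, N - 1`). -/
def dot (N : ℕ) {s : Side} (a : S s) : dotSide S s :=
  ⟨∑ i ∈ Finset.range N, copy S i s a,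
    sum_mem fun i _ => NonUnitalAlgebra.subset_adjoin ℂ ⟨i, a, rfl⟩⟩

end Dot

/-! ### Bi-monotonic cumulants -/

section Cumulants

variable {A : Type u} [NonUnitalRing A] [Module ℂ A] [IsScalarTower ℂ A A] [SMulCommClass ℂ A A]

/-- Families of functionals `K_χ : A_{χ(1)} × ⋯ × A_{χ(n)} → ℂ`. -/
abbrev FunctionalFamily (S : Side → NonUnitalSubalgebra ℂ A) : Type u :=
  ∀ (n : ℕ) (χ : Fin n → Side), (∀ j, S (χ j)) → ℂ

/-- Families of polynomials `Q_χ` in variables indexed by the nonempty proper subsets `V`. -/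
abbrev PolyFamily : Type :=
  ∀ (n : ℕ), (Fin n → Side) → MvPolynomial (ProperSub n) ℂ

/-- All `K_χ` are multilinear. -/
def IsMultilinearFamily {S : Side → NonUnitalSubalgebra ℂ A} (K : FunctionalFamily S) : Prop :=
  ∀ n, 1 ≤ n → ∀ χ : Fin n → Side,
    ∃ f : MultilinearMap ℂ (fun j => S (χ j)) ℂ, ∀ a, f a = K n χ a

/-- `φ(a₁ ⋯ aₙ) = K_χ(a₁, …, aₙ) + Q_χ({K_{χ|_V}((a₁, …, aₙ)|_V)}_V)`, where `V` runs over the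
nonempty proper subsets. -/
def MomentRelation (Q : PolyFamily) {S : Side → NonUnitalSubalgebra ℂ A} (φ : A →ₗ[ℂ] ℂ)
    (K : FunctionalFamily S) : Prop :=
  ∀ n, 1 ≤ n → ∀ (χ : Fin n → Side) (a : ∀ j, S (χ j)),
    (moment φ fun j => (a j : A)) =
      K n χ a +
        MvPolynomial.eval
          (fun V : ProperSub n =>
            K _ (restrictSide χ V.1) (restrictTuple (X := fun s => S s) a V.1))
          (Q n χ)

/-- `K` is a family of bi-monotonic cumulants of the pair `S` in `(A, φ)`, with the polynomials
`Q` and with `Φ` the bi-monotonic product functional on the enlarged space. Since the tuple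
`(N.a₁, …, N.aₙ)` lives in the enlarged space, the last condition refers to the functionals `Kd`
there, which are multilinear and tied to the moments by the same polynomials. -/
structure IsBiMonotonicCumulants (Q : PolyFamily) (S : Side → NonUnitalSubalgebra ℂ A)
    (φ : A →ₗ[ℂ] ℂ) (Φ : DotAlg S →ₗ[ℂ] ℂ) (K : FunctionalFamily S) : Prop where
  multilinear : IsMultilinearFamily K
  moment_relation : MomentRelation Q φ K
  extensive : ∃ Kd : FunctionalFamily (dotSide S),
    IsMultilinearFamily Kd ∧ MomentRelation Q Φ Kd ∧
      ∀ n, 1 ≤ n → ∀ (χ : Fin n → Side) (a : ∀ j, S (χ j)) (N : ℕ), 1 ≤ N →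
        Kd n χ (fun j => dot S N (a j)) = N * K n χ a

/-- Families of polynomials in `N` whose coefficients are polynomials in variables indexed by the
nonempty proper subsets `V`. -/
abbrev DotPolyFamily : Type :=
  ∀ (n : ℕ), (Fin n → Side) → Polynomial (MvPolynomial (ProperSub n) ℂ)

/-- The polynomial `φ(a₁ ⋯ aₙ) N + P_χ(N, {φ(a_V)}_V)` in the variable `N`. -/
def dotPoly (P : DotPolyFamily) {S : Side → NonUnitalSubalgebra ℂ A} (φ : A →ₗ[ℂ] ℂ) {n : ℕ}
    (χ : Fin n → Side) (a : ∀ j, S (χ j)) : Polynomial ℂ :=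
  Polynomial.C (moment φ fun j => (a j : A)) * Polynomial.X +
    (P n χ).map
      (MvPolynomial.eval fun V : ProperSub n =>
        moment φ fun j => (restrictTuple (X := fun s => S s) a V.1 j : A))

end Cumulants

end BiMonotonic

end

noncomputable section

namespace BiMonotonic

open TensorProduct

/-! ### Products over words -/

section Words

/-! Everything rests on an explicit formula for moments of words in the copies. Colour each letter
by the index of its copy. Letters of one colour form a block when no letter of smaller colour lies
between them in the order of `χ`, and the moment of the word is the product of the `φ(a_U)` over
these nested blocks `U` (`productFun_subWord`).

Existence of the product. Read a word from its last letter to its first: in the order of `χ` it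
grows at its two ends, at the front by left letters and at the back by right ones. Hence the blocks
of one level can be computed by operators on `R × (R ⊗ R)`, with `R` the unitization of `A`: either
a single block is open, or one block is open at each end. A letter of the level multiplies into the
block at its end, and a letter of a lower level closes that block by applying `φ`. Closing is
idempotent, so tensoring the lower copies with it is a homomorphism, and iterating over the levels
gives `productFun`. Conditional bi-freeness follows by writing the image of a lower letter `x` as
`(x - δ(x)) ⊗ close + δ(x) ⊗ 1` and expanding (`productFun_eq_zero_of_centred`).

Uniqueness of the product. The blocks of level `m` can be centred by adding scalars to their
letters. This changes moments only by moments of shorter words, and centred words have moment zero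
(`IsBiMonotonicProduct.eq_on_word`).

Polynomiality. The formula sees only the relative order of the colours. Grouping the colourings in
the expansion of `φ(N.a₁ ⋯ N.aₙ)` by the set of colours used therefore gives `∑ₖ (N choose k) cₖ`
(`sum_colourings`). Here `c₁ = φ(a₁ ⋯ aₙ)`, while for `k ≥ 2` all blocks are proper subsets.

Cumulants. The coefficient of `N` is the full moment plus a polynomial in moments over proper
subsets, a triangular relation that can be inverted (`exists_inverse_polynomials`). Nested blocks
inside nested blocks are the nested blocks of the lexicographic colouring (`nestBlocks_lex`), so the
polynomial of `N.a` at `M` is that of `a` at `MN`, which gives extensivity. For uniqueness, scaling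
all arguments by `t` leaves only the part of `Q_χ` of weight `n`. Its monomials are made of
cumulants of order less than `n`, hence have at least two factors and carry at least `N²`, so `K_χ`
must be the coefficient of `N`. -/

theorem filter_range_orderEmb {k n : ℕ} (e : Fin k ↪o Fin n) :
    (List.finRange n).filter (fun j => decide (j ∈ Set.range e)) = (List.finRange k).map e := by
  classical
  refine List.Perm.eq_of_pairwise (le := (· < ·)) (fun a b _ _ h h' => absurd h h'.asymm) ?_ ?_ ?_
  · exact (List.pairwise_lt_finRange n).filter _
  · exact List.pairwise_map.2 ((List.pairwise_lt_finRange k).imp fun h => e.strictMono h)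
  · refine (List.perm_ext_iff_of_nodup ?_ ?_).2 ?_
    · exact (List.nodup_finRange n).filter _
    · exact (List.nodup_finRange k).map e.injective
    · intro a
      simp

theorem prod_filter_eq_of_one {M ι : Type*} [Monoid M] (f : ι → M) (p : ι → Prop) [DecidablePred p]
    (l : List ι) (h : ∀ j, ¬ p j → f j = 1) :
    ((l.filter fun j => decide (p j)).map f).prod = (l.map f).prod := by
  induction l with
  | nil => rfl
  | cons x l ih =>
    by_cases hx : p x
    · simp [hx, ih]
    · simp [hx, ih, h x hx]

/-- Letters equal to `1` can be deleted from a word. -/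
theorem prod_ofFn_comp_orderEmb {M : Type*} [Monoid M] {k n : ℕ} (e : Fin k ↪o Fin n)
    (f : Fin n → M) (h : ∀ j, j ∉ Set.range e → f j = 1) :
    (List.ofFn fun i => f (e i)).prod = (List.ofFn f).prod := by
  classical
  rw [List.ofFn_eq_map, List.ofFn_eq_map, ← prod_filter_eq_of_one f (· ∈ Set.range e) _ h,
    filter_range_orderEmb, List.map_map]
  rfl

theorem prod_ofFn_orderEmbOfFin {M : Type*} [Monoid M] {n : ℕ} (a : Fin n → M)
    (V : Finset (Fin n)) :
    (List.ofFn fun j => a (V.orderEmbOfFin rfl j)).prod =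
      (List.ofFn fun j => if j ∈ V then a j else 1).prod := by
  rw [← prod_ofFn_comp_orderEmb (V.orderEmbOfFin rfl) fun j => if j ∈ V then a j else 1]
  · simp
  · intro j hj
    rw [Finset.range_orderEmbOfFin] at hj
    exact if_neg hj

theorem blockProd_eq {B : Type*} [Ring B] [Algebra ℂ B] {n : ℕ} (a : Fin n → B)
    (V : Finset (Fin n)) :
    blockProd a V = (List.ofFn fun j => if j ∈ V then a j else 1).prod :=
  prod_ofFn_orderEmbOfFin a V

theorem blockProd_univ {B : Type*} [Ring B] [Algebra ℂ B] {n : ℕ} (a : Fin n → B) :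
    blockProd a Finset.univ = (List.ofFn a).prod := by
  simp [blockProd_eq]

theorem blockProd_empty {B : Type*} [Ring B] [Algebra ℂ B] {n : ℕ} (a : Fin n → B) :
    blockProd a ∅ = 1 := by
  simp [blockProd_eq]

/-- Words are built from the last letter to the first: a letter put before every non-unit letter is
a left factor. -/
theorem prod_ofFn_update_min {M : Type*} [Monoid M] {n : ℕ} (f : Fin n → M) (t : Fin n) (y : M)
    (h : ∀ j ≤ t, f j = 1) :
    (List.ofFn (Function.update f t y)).prod = y * (List.ofFn f).prod := by
  induction n with
  | zero => exact t.elim0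
  | succ n ih =>
    rw [List.ofFn_succ, List.ofFn_succ, List.prod_cons, List.prod_cons, h 0 (Fin.zero_le t)]
    induction t using Fin.cases with
    | zero => simp
    | succ t =>
      have h0 : Function.update f t.succ y 0 = 1 := by
        rw [Function.update_of_ne (Fin.succ_ne_zero t).symm]
        exact h 0 (Fin.zero_le _)
      have h1 : (fun i : Fin n => Function.update f t.succ y i.succ) =
          Function.update (fun i : Fin n => f i.succ) t y := by
        funext i
        by_cases hi : i = t
        · subst hi; simp
        · rw [Function.update_of_ne hi, Function.update_of_ne]
          exact fun h => hi (Fin.succ_injective _ h)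
      rw [h0, h1, ih _ _ fun j hj => h _ (Fin.succ_le_succ_iff.2 hj), one_mul, one_mul]

theorem blockProd_insert_min {B : Type*} [Ring B] [Algebra ℂ B] {n : ℕ} (a : Fin n → B)
    (V : Finset (Fin n)) (t : Fin n) (h : ∀ j ∈ V, t < j) :
    blockProd a (insert t V) = a t * blockProd a V := by
  rw [blockProd_eq, blockProd_eq, ← prod_ofFn_update_min _ t]
  · congr 2
    funext j
    by_cases hj : j = t
    · subst hj; simp
    · simp [hj]
  · intro j hj
    exact if_neg fun hV => absurd (h j hV) (not_lt.2 hj)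

end Words

/-! ### Blocks determined by separators -/

section Blocks

variable {α : Type*} (r : α → α → Prop)

/-- `k` lies weakly between `i` and `j` for the relation `r`. -/
def Btw (i j k : α) : Prop := (r i k ∧ r k j) ∨ (r j k ∧ r k i)

open Classical in
/-- The elements of `L` which are not separated from `j` by an element of `E`. -/
def sepBlock (E L : Finset α) (j : α) : Finset α :=
  L.filter fun i => ∀ k ∈ E, ¬ Btw r i j k

/-- The blocks of `L` cut out by the separators `E`. -/
def sepBlocks [DecidableEq α] (E L : Finset α) : Finset (Finset α) :=
  L.image (sepBlock r E L)

open Classical in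
/-- The elements of `L` before all separators. -/
def initBlock (E L : Finset α) : Finset α :=
  L.filter fun i => ∀ k ∈ E, ¬ r k i

theorem mem_initBlock {E L : Finset α} {i : α} :
    i ∈ initBlock r E L ↔ i ∈ L ∧ ∀ k ∈ E, ¬ r k i := by
  simp [initBlock]

theorem mem_sepBlock {E L : Finset α} {i j : α} :
    i ∈ sepBlock r E L j ↔ i ∈ L ∧ ∀ k ∈ E, ¬ Btw r i j k := by
  simp [sepBlock]

theorem btw_flip (i j k : α) : Btw (flip r) i j k ↔ Btw r i j k := by
  simp only [Btw, flip]; tauto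

/-- Being between two points is insensitive to reversing the order. This reduces statements about
right letters to those about left letters, with `flip r` in place of `r`. -/
theorem sepBlocks_flip [DecidableEq α] (E L : Finset α) : sepBlocks (flip r) E L = sepBlocks r E L := by
  have : sepBlock (flip r) E L = sepBlock r E L := by
    funext j; ext i; simp only [mem_sepBlock, btw_flip]
  rw [sepBlocks, sepBlocks, this]

theorem mem_sepBlock_self [Std.Antisymm r] {E L : Finset α} (h : Disjoint E L) {j : α}
    (hj : j ∈ L) : j ∈ sepBlock r E L j := by
  refine (mem_sepBlock r).2 ⟨hj, fun k hk hb => ?_⟩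
  have : k = j := by
    rcases hb with hb | hb
    · exact antisymm_of r hb.2 hb.1
    · exact antisymm_of r hb.2 hb.1
  exact Finset.disjoint_left.1 h hk (this ▸ hj)

theorem empty_notMem_sepBlocks [DecidableEq α] [Std.Antisymm r] {E L : Finset α}
    (h : Disjoint E L) : ∅ ∉ sepBlocks r E L := by
  intro h0
  obtain ⟨j, hj, h1⟩ := Finset.mem_image.1 h0
  have := mem_sepBlock_self r h hj
  rw [h1] at this
  exact Finset.notMem_empty _ this

theorem subset_of_mem_sepBlocks [DecidableEq α] {E L V : Finset α} (h : V ∈ sepBlocks r E L) : V ⊆ L := by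
  obtain ⟨j, -, rfl⟩ := Finset.mem_image.1 h
  exact fun i hi => ((mem_sepBlock r).1 hi).1

theorem sepBlock_eq_initBlock [IsTrans α r] [Std.Total r] {E L : Finset α} {j : α}
    (hj : j ∈ initBlock r E L) : sepBlock r E L j = initBlock r E L := by
  obtain ⟨hjL, hj⟩ := (mem_initBlock r).1 hj
  ext i
  refine ⟨fun hi => ?_, fun hi => ?_⟩
  · obtain ⟨hiL, hi⟩ := (mem_sepBlock r).1 hi
    refine (mem_initBlock r).2 ⟨hiL, fun k hk hki => hi k hk (Or.inr ⟨?_, hki⟩)⟩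
    exact (total_of r j k).resolve_right (hj k hk)
  · obtain ⟨hiL, hi⟩ := (mem_initBlock r).1 hi
    refine (mem_sepBlock r).2 ⟨hiL, fun k hk hb => ?_⟩
    rcases hb with hb | hb
    · exact hj k hk hb.2
    · exact hi k hk hb.2

theorem initBlock_eq_empty_or_mem [DecidableEq α] [IsTrans α r] [Std.Total r] (E L : Finset α) :
    initBlock r E L = ∅ ∨ initBlock r E L ∈ sepBlocks r E L := by
  rcases Finset.eq_empty_or_nonempty (initBlock r E L) with h | ⟨j, hj⟩
  · exact Or.inl h
  · exact Or.inr (Finset.mem_image.2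
      ⟨j, ((mem_initBlock r).1 hj).1, sepBlock_eq_initBlock r hj⟩)

theorem disjoint_initBlock_flip [Std.Total r] {E : Finset α} (hE : E.Nonempty) (L : Finset α) :
    Disjoint (initBlock r E L) (initBlock (flip r) E L) := by
  obtain ⟨e, he⟩ := hE
  refine Finset.disjoint_left.2 fun j h1 h2 => ?_
  rcases total_of r e j with h | h
  · exact ((mem_initBlock _).1 h1).2 e he h
  · exact ((mem_initBlock _).1 h2).2 e he h

section Insert

variable [DecidableEq α] {r} {E L : Finset α} {t : α}

theorem initBlock_insert_right (hE : ∀ j ∈ E, ¬ r j t) :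
    initBlock r E (insert t L) = insert t (initBlock r E L) := by
  ext i
  simp only [mem_initBlock, Finset.mem_insert]
  constructor
  · rintro ⟨rfl | h, h'⟩
    · exact Or.inl rfl
    · exact Or.inr ⟨h, h'⟩
  · rintro (rfl | h)
    · exact ⟨Or.inl rfl, hE⟩
    · exact ⟨Or.inr h.1, h.2⟩

theorem initBlock_flip_insert_right (hE0 : E.Nonempty) (hE : ∀ j ∈ E, r t j) :
    initBlock (flip r) E (insert t L) = initBlock (flip r) E L := by
  ext i
  simp only [mem_initBlock, Finset.mem_insert, flip]
  constructor
  · rintro ⟨rfl | h, h'⟩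
    · obtain ⟨e, he⟩ := hE0
      exact absurd (hE e he) (h' e he)
    · exact ⟨h, h'⟩
  · rintro h
    exact ⟨Or.inr h.1, h.2⟩

/-- A separator in front of everything leaves the blocks of `L` as they are, but the initial block
is no longer open: the next letter starts a new one. -/
theorem initBlock_insert_left (hL : ∀ j ∈ L, r t j) : initBlock r (insert t E) L = ∅ := by
  refine Finset.eq_empty_of_forall_notMem fun i h => ?_
  rw [mem_initBlock] at h
  exact h.2 t (Finset.mem_insert_self _ _) (hL i h.1)

theorem initBlock_flip_insert_left (hL : ∀ j ∈ L, ¬ r j t) :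
    initBlock (flip r) (insert t E) L = initBlock (flip r) E L := by
  ext i
  simp only [mem_initBlock, Finset.mem_insert, flip]
  constructor
  · rintro ⟨h, h'⟩
    exact ⟨h, fun k hk => h' k (Or.inr hk)⟩
  · rintro ⟨h, h'⟩
    refine ⟨h, ?_⟩
    rintro k (rfl | hk)
    · exact hL i h
    · exact h' k hk

theorem sepBlocks_insert_left (hL : ∀ j ∈ L, ¬ r j t) :
    sepBlocks r (insert t E) L = sepBlocks r E L := by
  refine Finset.image_congr fun j hj => ?_
  ext i
  simp only [mem_sepBlock, Finset.mem_insert]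
  constructor
  · rintro ⟨h, h'⟩
    exact ⟨h, fun k hk => h' k (Or.inr hk)⟩
  · rintro ⟨h, h'⟩
    refine ⟨h, ?_⟩
    rintro k (rfl | hk)
    · rintro (hb | hb)
      · exact hL i h hb.1
      · exact hL j hj hb.1
    · exact h' k hk

/-- A letter in front of everything joins the initial block and touches no other. If that block is
empty, the erasure is void, since no block is empty, and the singleton of `t` is a new block. -/
theorem sepBlocks_insert_right [IsTrans α r] [Std.Total r] [Std.Antisymm r]
    (hd : Disjoint E L) (hE : ∀ j ∈ E, r t j) (hE' : ∀ j ∈ E, ¬ r j t) :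
    sepBlocks r E (insert t L) =
      insert (insert t (initBlock r E L)) ((sepBlocks r E L).erase (initBlock r E L)) := by
  have ht : t ∈ initBlock r E (insert t L) :=
    (mem_initBlock r).2 ⟨Finset.mem_insert_self _ _, hE'⟩
  have key : ∀ j ∈ L, j ∉ initBlock r E L → sepBlock r E (insert t L) j = sepBlock r E L j := by
    intro j hj hjU
    ext i
    simp only [mem_sepBlock, Finset.mem_insert]
    refine ⟨?_, fun h => ⟨Or.inr h.1, h.2⟩⟩
    rintro ⟨rfl | h, h'⟩
    · exact absurd ((mem_initBlock r).2
        ⟨hj, fun k hk hkj => h' k hk (Or.inl ⟨hE k hk, hkj⟩)⟩) hjU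
    · exact ⟨h, h'⟩
  rw [sepBlocks, Finset.image_insert, sepBlock_eq_initBlock r ht, initBlock_insert_right hE']
  ext V
  simp only [Finset.mem_insert, Finset.mem_erase, Finset.mem_image, sepBlocks]
  refine or_congr_right' fun hV => ⟨?_, ?_⟩
  · rintro ⟨j, hj, rfl⟩
    have hjU : j ∉ initBlock r E L := by
      intro hjU
      refine hV ?_
      rw [sepBlock_eq_initBlock, initBlock_insert_right hE']
      rw [initBlock_insert_right hE']
      exact Finset.mem_insert_of_mem hjU
    have hjj : sepBlock r E L j ≠ initBlock r E L :=
      fun h => hjU (h ▸ mem_sepBlock_self r hd hj)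
    exact ⟨by rw [key j hj hjU]; exact hjj, j, hj, (key j hj hjU).symm⟩
  · rintro ⟨hVU, j, hj, rfl⟩
    have hjU : j ∉ initBlock r E L := fun h => hVU (sepBlock_eq_initBlock r h)
    exact ⟨j, hj, key j hj hjU⟩

end Insert

end Blocks

/-! ### The order of positions -/

section ChiOrder

variable {n : ℕ} (χ : Fin n → Side)

instance : Std.Total (chiLE χ) where
  total i j := by
    unfold chiLE
    cases χ i <;> cases χ j <;> simp <;> exact le_total _ _

instance : IsTrans (Fin n) (chiLE χ) where
  trans i j k := by
    unfold chiLE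
    cases χ i <;> cases χ j <;> cases χ k <;> simp <;> intro h h' <;> omega

instance : Std.Antisymm (chiLE χ) where
  antisymm i j := by
    unfold chiLE
    cases χ i <;> cases χ j <;> simp <;> intro h h' <;> omega

instance : Std.Total (flip (chiLE χ)) where
  total i j := total_of (chiLE χ) j i

instance : IsTrans (Fin n) (flip (chiLE χ)) where
  trans _ _ _ h h' := trans_of (chiLE χ) h' h

instance : Std.Antisymm (flip (chiLE χ)) where
  antisymm _ _ h h' := antisymm_of (chiLE χ) h' h

variable {χ}

/-- With positions added in decreasing order, a new left position comes first for `χ` and a new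
right position comes last. -/
theorem chiLE_of_left {t j : Fin n} (ht : χ t = Side.left) (h : t < j) : chiLE χ t j := by
  unfold chiLE
  rw [ht]
  cases χ j <;> simp [h.le]

theorem not_chiLE_of_left {t j : Fin n} (ht : χ t = Side.left) (h : t < j) : ¬ chiLE χ j t := by
  unfold chiLE
  rw [ht]
  cases χ j <;> simp [h]

theorem chiLE_of_right {t j : Fin n} (ht : χ t = Side.right) (h : t < j) : chiLE χ j t := by
  unfold chiLE
  rw [ht]
  cases χ j <;> simp [h.le]

theorem not_chiLE_of_right {t j : Fin n} (ht : χ t = Side.right) (h : t < j) :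
    ¬ chiLE χ t j := by
  unfold chiLE
  rw [ht]
  cases χ j <;> simp [h]

end ChiOrder

/-! ### The space of joined and separated states -/

section StateSpace

variable {R : Type u} [Ring R] [Algebra ℂ R] (ψ : R →ₗ[ℂ] ℂ)

/-- States of one level: either all letters are joined, or the letters on the left are separated
from those on the right. -/
abbrev StateSpace (R : Type u) [Ring R] [Algebra ℂ R] : Type u := R × (R ⊗[ℂ] R)

/-- Close the currently open block on a given side. -/
def closeOp : Side → Module.End ℂ (StateSpace R)
  -- From the joined state, the whole block becomes the open block of the other side and `1` starts
  -- a new one here. From the separated state, the open block of this side is replaced by its value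
  -- under `ψ` times `1`.
  | Side.left => LinearMap.inr ℂ R (R ⊗[ℂ] R) ∘ₗ
      LinearMap.coprod (TensorProduct.mk ℂ R R 1)
        (TensorProduct.map (ψ.smulRight (1 : R)) LinearMap.id)
  | Side.right => LinearMap.inr ℂ R (R ⊗[ℂ] R) ∘ₗ
      LinearMap.coprod ((TensorProduct.mk ℂ R R).flip 1)
        (TensorProduct.map LinearMap.id (ψ.smulRight (1 : R)))

/-- Multiplication into the currently open block on a given side. -/
def actOp : Side → R →ₐ[ℂ] Module.End ℂ (StateSpace R)
  | Side.left => AlgHom.ofLinearMap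
      { toFun := fun b => LinearMap.prodMap (LinearMap.mulLeft ℂ b)
          (TensorProduct.map (LinearMap.mulLeft ℂ b) LinearMap.id)
        map_add' := fun b c => by
          ext <;> simp [add_mul, TensorProduct.add_tmul]
        map_smul' := fun b c => by
          ext <;> simp [TensorProduct.smul_tmul'] }
      (by ext <;> simp) (fun b c => by ext <;> simp)
  -- Right letters also multiply from the left, because `a_V` is ordered by position and positions
  -- are read from last to first.
  | Side.right => AlgHom.ofLinearMap
      { toFun := fun b => LinearMap.prodMap (LinearMap.mulLeft ℂ b)
          (TensorProduct.map LinearMap.id (LinearMap.mulLeft ℂ b))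
        map_add' := fun b c => by
          ext <;> simp [add_mul, TensorProduct.tmul_add]
        map_smul' := fun b c => by
          ext <;> simp }
      (by ext <;> simp) (fun b c => by ext <;> simp)

/-- The functional closing all open blocks. -/
def finalFun : StateSpace R →ₗ[ℂ] ℂ :=
  LinearMap.coprod ψ (TensorProduct.lift ((LinearMap.mul ℂ ℂ).compl₁₂ ψ ψ))

/-- The vacuum state. -/
def vacState : Module.End ℂ (StateSpace R) →ₗ[ℂ] ℂ :=
  finalFun ψ ∘ₗ LinearMap.applyₗ ((1, 0) : StateSpace R)

theorem closeOp_left_joined (x : R) : closeOp ψ Side.left (x, 0) = (0, 1 ⊗ₜ x) := by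
  simp [closeOp]

theorem closeOp_right_joined (x : R) : closeOp ψ Side.right (x, 0) = (0, x ⊗ₜ 1) := by
  simp [closeOp]

theorem closeOp_left_tmul (u x : R) :
    closeOp ψ Side.left (0, u ⊗ₜ x) = ψ u • (0, 1 ⊗ₜ x) := by
  simp [closeOp, TensorProduct.smul_tmul']

theorem closeOp_right_tmul (u x : R) :
    closeOp ψ Side.right (0, u ⊗ₜ x) = ψ x • (0, u ⊗ₜ 1) := by
  simp [closeOp]

/-- Closing the fresh block `1` costs the factor `ψ 1 = 1`. Idempotence is what makes tensoring with
`closeOp` multiplicative in `levelLetter`. -/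
theorem closeOp_mul_self (h1 : ψ 1 = 1) (s : Side) : closeOp ψ s * closeOp ψ s = closeOp ψ s := by
  cases s <;> ext <;> simp [closeOp, h1]

theorem actOp_joined (s : Side) (b x : R) : actOp s b (x, 0) = (b * x, 0) := by
  cases s <;> simp [actOp]

theorem actOp_left_tmul (b u x : R) : actOp Side.left b (0, u ⊗ₜ x) = (0, (b * u) ⊗ₜ x) := by
  simp [actOp]

theorem actOp_right_tmul (b u x : R) : actOp Side.right b (0, u ⊗ₜ x) = (0, u ⊗ₜ (b * x)) := by
  simp [actOp]

theorem finalFun_joined (x : R) : finalFun ψ (x, 0) = ψ x := by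
  simp [finalFun]

theorem finalFun_tmul (u x : R) : finalFun ψ (0, u ⊗ₜ x) = ψ u * ψ x := by
  simp [finalFun]

/-! ### Reading a word from its last letter to its first -/

variable {n : ℕ} (χ : Fin n → Side) (b : Fin n → R)

/-- The operator of a position: closing for separators, multiplication for the elements of `L`,
the identity otherwise. -/
def letterOp (E L : Finset (Fin n)) (j : Fin n) : Module.End ℂ (StateSpace R) :=
  if j ∈ E then closeOp ψ (χ j) else if j ∈ L then actOp (χ j) (b j) else 1

/-- The second alternative serves the empty open block, which is not among the blocks and has value
`ψ 1 = 1`. -/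
theorem prod_erase_mul {ι : Type*} [DecidableEq ι] (S : Finset ι) (g : ι → ℂ) (X : ι)
    (h : X ∈ S ∨ (X ∉ S ∧ g X = 1)) : (∏ V ∈ S.erase X, g V) * g X = ∏ V ∈ S, g V := by
  rcases h with h | h
  · exact Finset.prod_erase_mul _ _ h
  · rw [Finset.erase_eq_of_notMem h.1, h.2, mul_one]

/-- The value of the state reached from the vacuum. -/
structure IsReached (E L : Finset (Fin n)) : Prop where
  joined : E = ∅ → (List.ofFn (letterOp ψ χ b E L)).prod ((1, 0) : StateSpace R) =
    (blockProd b L, 0)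
  -- The two open blocks, possibly empty, are stored in the tensor and so are omitted from the
  -- product.
  separated : E ≠ ∅ → (List.ofFn (letterOp ψ χ b E L)).prod ((1, 0) : StateSpace R) =
    (∏ V ∈ ((sepBlocks (chiLE χ) E L).erase (initBlock (chiLE χ) E L)).erase
      (initBlock (flip (chiLE χ)) E L), ψ (blockProd b V)) •
      ((0, blockProd b (initBlock (chiLE χ) E L) ⊗ₜ
        blockProd b (initBlock (flip (chiLE χ)) E L)) : StateSpace R)

variable {ψ χ b} {E L : Finset (Fin n)} {t : Fin n}

theorem prod_letterOp_insert_left (hE : ∀ j ∈ E, t < j) (hL : ∀ j ∈ L, t < j) :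
    (List.ofFn (letterOp ψ χ b (insert t E) L)).prod =
      closeOp ψ (χ t) * (List.ofFn (letterOp ψ χ b E L)).prod := by
  rw [← prod_ofFn_update_min _ t]
  · congr 2
    funext j
    by_cases hj : j = t
    · subst hj; simp [letterOp]
    · simp [hj, letterOp]
  · intro j hj
    have h1 : j ∉ E := fun h => absurd (hE j h) (not_lt.2 hj)
    have h2 : j ∉ L := fun h => absurd (hL j h) (not_lt.2 hj)
    simp [letterOp, h1, h2]

theorem prod_letterOp_insert_right (hE : ∀ j ∈ E, t < j) (hL : ∀ j ∈ L, t < j) :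
    (List.ofFn (letterOp ψ χ b E (insert t L))).prod =
      actOp (χ t) (b t) * (List.ofFn (letterOp ψ χ b E L)).prod := by
  rw [← prod_ofFn_update_min _ t]
  · congr 2
    funext j
    by_cases hj : j = t
    · subst hj
      have : j ∉ E := fun h => lt_irrefl _ (hE j h)
      simp [letterOp, this]
    · simp [hj, letterOp]
  · intro j hj
    have h1 : j ∉ E := fun h => absurd (hE j h) (not_lt.2 hj)
    have h2 : j ∉ L := fun h => absurd (hL j h) (not_lt.2 hj)
    simp [letterOp, h1, h2]

theorem sepBlocks_empty_subset {α : Type*} [DecidableEq α] (r : α → α → Prop) (L : Finset α) :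
    sepBlocks r ∅ L ⊆ {L} := by
  intro V hV
  obtain ⟨j, -, rfl⟩ := Finset.mem_image.1 hV
  rw [Finset.mem_singleton]
  ext i
  simp [mem_sepBlock]

theorem initBlock_empty {α : Type*} (r : α → α → Prop) (L : Finset α) :
    initBlock r ∅ L = L := by
  ext i
  simp [mem_initBlock]

/-- Once there is a separator the two open blocks are disjoint, so they can only coincide when
empty. Removing both from the product therefore never removes one nonempty block twice. -/
theorem initBlock_ne_flip {r : Fin n → Fin n → Prop} [Std.Total r] (hE : E ≠ ∅)
    (h : initBlock r E L = initBlock (flip r) E L) : initBlock r E L = ∅ := by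
  have := disjoint_initBlock_flip r (Finset.nonempty_iff_ne_empty.2 hE) L
  rw [← h] at this
  exact Finset.disjoint_self_iff_empty _ |>.1 this

theorem erase_insert_erase {ι : Type*} [DecidableEq ι] (S : Finset ι) (X Y : ι) (h : Y ∉ S) :
    (insert Y (S.erase X)).erase Y = S.erase X :=
  Finset.erase_insert fun h' => h (Finset.mem_of_mem_erase h')

theorem insert_notMem_sepBlocks {r : Fin n → Fin n → Prop} (ht : t ∉ L) (U : Finset (Fin n)) :
    insert t U ∉ sepBlocks r E L :=
  fun h => ht (subset_of_mem_sepBlocks r h (Finset.mem_insert_self _ _))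

theorem IsReached.insert_right (h : IsReached ψ χ b E L) (hd : Disjoint E L)
    (hE : ∀ j ∈ E, t < j) (hL : ∀ j ∈ L, t < j) : IsReached ψ χ b E (insert t L) := by
  have htL : t ∉ L := fun h => lt_irrefl _ (hL t h)
  refine ⟨fun h0 => ?_, fun h0 => ?_⟩
  · rw [prod_letterOp_insert_right hE hL, Module.End.mul_apply, h.joined h0, actOp_joined,
      blockProd_insert_min b L t hL]
  · have hne := Finset.nonempty_iff_ne_empty.2 h0
    rw [prod_letterOp_insert_right hE hL, Module.End.mul_apply, h.separated h0]
    cases hs : χ t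
    · have e1 : ∀ j ∈ E, chiLE χ t j := fun j hj => chiLE_of_left hs (hE j hj)
      have e2 : ∀ j ∈ E, ¬ chiLE χ j t := fun j hj => not_chiLE_of_left hs (hE j hj)
      rw [initBlock_insert_right e2, initBlock_flip_insert_right hne e1,
        sepBlocks_insert_right hd e1 e2, erase_insert_erase _ _ _ (insert_notMem_sepBlocks htL _),
        map_smul, actOp_left_tmul, blockProd_insert_min b _ t
          fun j hj => hL j ((mem_initBlock _).1 hj).1]
    · have e1 : ∀ j ∈ E, flip (chiLE χ) t j := fun j hj => chiLE_of_right hs (hE j hj)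
      have e2 : ∀ j ∈ E, ¬ flip (chiLE χ) j t := fun j hj => not_chiLE_of_right hs (hE j hj)
      have e3 := initBlock_flip_insert_right (L := L) hne e1
      rw [show flip (flip (chiLE χ)) = chiLE χ from rfl] at e3
      have e4 : sepBlocks (chiLE χ) E (insert t L) =
          insert (insert t (initBlock (flip (chiLE χ)) E L))
            ((sepBlocks (chiLE χ) E L).erase (initBlock (flip (chiLE χ)) E L)) := by
        rw [← sepBlocks_flip, sepBlocks_insert_right hd e1 e2, sepBlocks_flip]
      rw [e3, initBlock_insert_right e2, e4, map_smul, actOp_right_tmul,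
        Finset.erase_right_comm (a := initBlock (chiLE χ) E L) (b := insert t _),
        erase_insert_erase _ _ _ (insert_notMem_sepBlocks htL _), Finset.erase_right_comm,
        blockProd_insert_min b _ t fun j hj => hL j ((mem_initBlock _).1 hj).1]

theorem IsReached.insert_left (h1 : ψ 1 = 1) (h : IsReached ψ χ b E L) (hd : Disjoint E L)
    (hE : ∀ j ∈ E, t < j) (hL : ∀ j ∈ L, t < j) : IsReached ψ χ b (insert t E) L := by
  have hem := empty_notMem_sepBlocks (chiLE χ) hd
  refine ⟨fun h0 => absurd h0 (Finset.insert_ne_empty _ _), fun _ => ?_⟩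
  rw [prod_letterOp_insert_left hE hL, Module.End.mul_apply]
  -- At the first separator nothing has been closed yet: `L` passes to the other end as an open
  -- block.
  have hsingle : E = ∅ → ∏ V ∈ ((sepBlocks (chiLE χ) E L).erase ∅).erase L,
      ψ (blockProd b V) = 1 := by
    rintro rfl
    refine Finset.prod_eq_one fun V hV => ?_
    rw [Finset.mem_erase, Finset.mem_erase] at hV
    exact absurd (Finset.mem_singleton.1 (sepBlocks_empty_subset _ _ hV.2.2)) hV.1
  -- The value of the block being closed moves from the tensor into the product; the `∅` erased on
  -- the right is the fresh open block. A general `r` covers both sides.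
  have hclose : ∀ (r : Fin n → Fin n → Prop) [IsTrans (Fin n) r] [Std.Total r], E ≠ ∅ →
      sepBlocks r E L = sepBlocks (chiLE χ) E L →
      (∏ V ∈ ((sepBlocks (chiLE χ) E L).erase (initBlock (flip r) E L)).erase (initBlock r E L),
        ψ (blockProd b V)) * ψ (blockProd b (initBlock r E L)) =
      ∏ V ∈ ((sepBlocks (chiLE χ) E L).erase (initBlock (flip r) E L)).erase ∅,
        ψ (blockProd b V) := by
    intro r _ _ h0 hr
    rw [prod_erase_mul, Finset.erase_eq_of_notMem (a := ∅)]
    · exact fun h => hem (Finset.mem_of_mem_erase h)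
    · by_cases h2 : initBlock r E L = ∅
      · right
        rw [h2]
        exact ⟨fun h => hem (Finset.mem_of_mem_erase h), by rw [blockProd_empty, h1]⟩
      · left
        refine Finset.mem_erase.2 ⟨fun h => h2 (initBlock_ne_flip h0 h), ?_⟩
        rw [← hr]
        exact (initBlock_eq_empty_or_mem r E L).resolve_left h2
  cases hs : χ t
  · have e1 : ∀ j ∈ L, chiLE χ t j := fun j hj => chiLE_of_left hs (hL j hj)
    have e2 : ∀ j ∈ L, ¬ chiLE χ j t := fun j hj => not_chiLE_of_left hs (hL j hj)
    rw [initBlock_insert_left e1, initBlock_flip_insert_left e2, sepBlocks_insert_left e2,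
      blockProd_empty]
    by_cases h0 : E = ∅
    · rw [h.joined h0, closeOp_left_joined]
      have := hsingle h0
      subst h0
      rw [initBlock_empty, this, one_smul]
    · rw [h.separated h0, map_smul, closeOp_left_tmul, smul_smul, Finset.erase_right_comm,
        hclose (chiLE χ) h0 rfl, Finset.erase_right_comm]
  · have e1 : ∀ j ∈ L, flip (chiLE χ) t j := fun j hj => chiLE_of_right hs (hL j hj)
    have e2 : ∀ j ∈ L, ¬ flip (chiLE χ) j t := fun j hj => not_chiLE_of_right hs (hL j hj)
    have e3 := initBlock_flip_insert_left (E := E) e2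
    rw [show flip (flip (chiLE χ)) = chiLE χ from rfl] at e3
    rw [e3, initBlock_insert_left e1, ← sepBlocks_flip (chiLE χ) (insert t E),
      sepBlocks_insert_left e2, blockProd_empty, sepBlocks_flip]
    by_cases h0 : E = ∅
    · rw [h.joined h0, closeOp_right_joined]
      have := hsingle h0
      subst h0
      rw [initBlock_empty, Finset.erase_right_comm, this, one_smul]
    · rw [h.separated h0, map_smul, closeOp_right_tmul, smul_smul]
      congr 1
      exact hclose (flip (chiLE χ)) h0 (sepBlocks_flip _ _ _)

theorem isReached (h1 : ψ 1 = 1) (E L : Finset (Fin n)) (hd : Disjoint E L) :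
    IsReached ψ χ b E L := by
  -- Positions are admitted in decreasing order, so that each new one is the last to act on the
  -- state.
  suffices H : ∀ s : Finset (Fin n), IsReached ψ χ b (E ∩ s) (L ∩ s) by
    simpa using H Finset.univ
  intro s
  induction s using Finset.induction_on_min with
  | empty =>
    refine ⟨fun _ => ?_, fun h => absurd (Finset.inter_empty E) h⟩
    rw [Finset.inter_empty, Finset.inter_empty, blockProd_empty,
      show letterOp ψ χ b ∅ ∅ = fun _ => 1 by funext j; simp [letterOp]]
    simp
  | insert t s hs ih =>
    have hE : ∀ j ∈ E ∩ s, t < j := fun j hj => hs j (Finset.mem_inter.1 hj).2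
    have hL : ∀ j ∈ L ∩ s, t < j := fun j hj => hs j (Finset.mem_inter.1 hj).2
    have hd' : Disjoint (E ∩ s) (L ∩ s) :=
      hd.mono Finset.inter_subset_left Finset.inter_subset_left
    by_cases htE : t ∈ E
    · rw [Finset.inter_insert_of_mem htE,
        Finset.inter_insert_of_notMem (Finset.disjoint_left.1 hd htE)]
      exact ih.insert_left h1 hd' hE hL
    · rw [Finset.inter_insert_of_notMem htE]
      by_cases htL : t ∈ L
      · rw [Finset.inter_insert_of_mem htL]
        exact ih.insert_right hd' hE hL
      · rw [Finset.inter_insert_of_notMem htL]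
        exact ih

/-- `finalFun` applies `ψ` to the open blocks, the only ones still missing from the product. -/
theorem vacState_prod (h1 : ψ 1 = 1) (E L : Finset (Fin n)) (hd : Disjoint E L) :
    vacState ψ (List.ofFn (letterOp ψ χ b E L)).prod =
      ∏ V ∈ sepBlocks (chiLE χ) E L, ψ (blockProd b V) := by
  have h := isReached (χ := χ) (b := b) h1 E L hd
  have hem := empty_notMem_sepBlocks (chiLE χ) hd
  by_cases h0 : E = ∅
  · rw [vacState, LinearMap.comp_apply, LinearMap.applyₗ_apply_apply, h.joined h0, finalFun_joined]
    subst h0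
    rcases Finset.eq_empty_or_nonempty L with rfl | ⟨j, hj⟩
    · simp [sepBlocks, blockProd_empty, h1]
    · rw [(Finset.subset_singleton_iff.1 (sepBlocks_empty_subset (chiLE χ) L)).resolve_left,
        Finset.prod_singleton]
      exact Finset.ne_empty_of_mem (Finset.mem_image_of_mem _ hj)
  · rw [vacState, LinearMap.comp_apply, LinearMap.applyₗ_apply_apply, h.separated h0, map_smul,
      finalFun_tmul, smul_eq_mul, mul_comm (ψ _), ← mul_assoc, prod_erase_mul, prod_erase_mul]
    · by_cases h2 : initBlock (chiLE χ) E L = ∅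
      · right
        rw [h2]
        exact ⟨hem, by rw [blockProd_empty, h1]⟩
      · exact Or.inl ((initBlock_eq_empty_or_mem _ E L).resolve_left h2)
    · by_cases h2 : initBlock (flip (chiLE χ)) E L = ∅
      · right
        rw [h2]
        exact ⟨fun h => hem (Finset.mem_of_mem_erase h), by rw [blockProd_empty, h1]⟩
      · left
        refine Finset.mem_erase.2 ⟨fun h => h2 (h.trans (initBlock_ne_flip h0 h.symm)), ?_⟩
        rw [← sepBlocks_flip]
        exact (initBlock_eq_empty_or_mem _ E L).resolve_left h2

variable (R) in
/-- The algebra of operators on the state space. -/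
def OpAlg : Type u := Module.End ℂ (StateSpace R)

instance : Ring (OpAlg R) := inferInstanceAs (Ring (Module.End ℂ (StateSpace R)))

instance : Algebra ℂ (OpAlg R) := inferInstanceAs (Algebra ℂ (Module.End ℂ (StateSpace R)))

variable (ψ) in
/-- `closeOp` as an element of `OpAlg R`. -/
def opClose (s : Side) : OpAlg R := closeOp ψ s

/-- `actOp` with values in `OpAlg R`. -/
def opAct (s : Side) : R →ₐ[ℂ] OpAlg R := actOp s

variable (ψ) in
/-- The vacuum state on `OpAlg R`. -/
def opState : OpAlg R →ₗ[ℂ] ℂ := vacState ψ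

theorem opClose_mul_self (h1 : ψ 1 = 1) (s : Side) : opClose ψ s * opClose ψ s = opClose ψ s :=
  closeOp_mul_self ψ h1 s

variable (ψ χ b) in
/-- `letterOp` with values in `OpAlg R`. -/
def opLetter (E L : Finset (Fin n)) (j : Fin n) : OpAlg R :=
  if j ∈ E then opClose ψ (χ j) else if j ∈ L then opAct (χ j) (b j) else 1

/-- The vacuum expectation of a word is the product of the expectations of its blocks. -/
theorem opState_prod (h1 : ψ 1 = 1) (E L : Finset (Fin n)) (hd : Disjoint E L) :
    opState ψ (List.ofFn (opLetter ψ χ b E L)).prod =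
      ∏ V ∈ sepBlocks (chiLE χ) E L, ψ (blockProd b V) :=
  vacState_prod h1 E L hd

end StateSpace

/-! ### The enlarged algebra -/

section Enlarged

variable {A : Type u} [NonUnitalRing A] [Module ℂ A] [IsScalarTower ℂ A A] [SMulCommClass ℂ A A]
variable (S : Side → NonUnitalSubalgebra ℂ A)

/-- The embedding of a unitized copy. -/
def copyUnit (i : ℕ) (s : Side) : Unitization ℂ (S s) →ₐ[ℂ] DotAlg S :=
  LinearAlgebra.FreeProduct.ι ℂ (fun p : ℕ × Side => Unitization ℂ (S p.2)) (i, s)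

/-- The embedding of a copy as a homomorphism. -/
def copyHom (i : ℕ) (s : Side) : S s →ₙₐ[ℂ] DotAlg S :=
  (copyUnit S i s : Unitization ℂ (S s) →ₙₐ[ℂ] DotAlg S).comp
    (Unitization.inrNonUnitalAlgHom ℂ (S s))

theorem copyHom_apply (i : ℕ) (s : Side) (a : S s) : copyHom S i s a = copy S i s a := rfl

variable {S}

/-- The homomorphism from the enlarged algebra given by homomorphisms on all unitized copies. -/
def unitLift {C : Type*} [Semiring C] [Algebra ℂ C]
    (g : ∀ p : ℕ × Side, Unitization ℂ (S p.2) →ₐ[ℂ] C) : DotAlg S →ₐ[ℂ] C :=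
  LinearAlgebra.FreeProduct.lift ℂ (fun p : ℕ × Side => Unitization ℂ (S p.2)) (fun {p} => g p)

theorem unitLift_copy {C : Type*} [Semiring C] [Algebra ℂ C]
    (g : ∀ p : ℕ × Side, Unitization ℂ (S p.2) →ₐ[ℂ] C) (i : ℕ) (s : Side) (a : S s) :
    unitLift g (copy S i s a) = g (i, s) (Unitization.inr a) :=
  DFunLike.congr_fun (LinearAlgebra.FreeProduct.lift_comp_ι ℂ
    (fun p : ℕ × Side => Unitization ℂ (S p.2)) (fun {_} => g _) (i := (i, s)))
    (Unitization.inr a)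

theorem unitLift_unique {C : Type*} [Semiring C] [Algebra ℂ C]
    (g : ∀ p : ℕ × Side, Unitization ℂ (S p.2) →ₐ[ℂ] C) (f : DotAlg S →ₐ[ℂ] C)
    (h : ∀ p, f.comp (copyUnit S p.1 p.2) = g p) : f = unitLift g :=
  LinearAlgebra.FreeProduct.lift_unique ℂ (fun p : ℕ × Side => Unitization ℂ (S p.2))
    (fun {p} => g p) f h

/-- The homomorphism from the enlarged algebra given by homomorphisms on all copies. -/
def dotLift {C : Type*} [Semiring C] [Algebra ℂ C] (f : ∀ (i : ℕ) (s : Side), S s →ₙₐ[ℂ] C) :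
    DotAlg S →ₐ[ℂ] C :=
  unitLift fun p => Unitization.lift (f p.1 p.2)

theorem dotLift_copy {C : Type*} [Semiring C] [Algebra ℂ C]
    (f : ∀ (i : ℕ) (s : Side), S s →ₙₐ[ℂ] C) (i : ℕ) (s : Side) (a : S s) :
    dotLift f (copy S i s a) = f i s a := by
  rw [dotLift, unitLift_copy]
  simp

theorem delta_copy (i : ℕ) (s : Side) (a : S s) : delta S (copy S i s a) = 0 :=
  (unitLift_copy (fun p => Unitization.fstHom ℂ (S p.2)) i s a).trans (by simp)

theorem dotAlg_hom_ext {C : Type*} [Semiring C] [Algebra ℂ C] {f g : DotAlg S →ₐ[ℂ] C}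
    (h : ∀ i s a, f (copy S i s a) = g (copy S i s a)) : f = g := by
  rw [unitLift_unique (fun p => f.comp (copyUnit S p.1 p.2)) f fun _ => rfl,
    unitLift_unique (fun p => g.comp (copyUnit S p.1 p.2)) g fun _ => rfl]
  congr 1
  funext p
  refine Unitization.algHom_ext' ?_
  ext a
  exact h p.1 p.2 a

/-- The word in the given copies. -/
def word {n : ℕ} (ω : Fin n → ℕ) {χ : Fin n → Side} (a : ∀ j, S (χ j)) : DotAlg S :=
  (List.ofFn fun j => copy S (ω j) (χ j) (a j)).prod

variable (S) in
/-- The unital subalgebra generated by all copies with index in `I`. -/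
def allCopies (I : Set ℕ) : Subalgebra ℂ (DotAlg S) :=
  Algebra.adjoin ℂ {x | ∃ i ∈ I, ∃ (s : Side) (a : S s), x = copy S i s a}

theorem copy_mem_allCopies {I : Set ℕ} {i : ℕ} (hi : i ∈ I) (s : Side) (a : S s) :
    copy S i s a ∈ allCopies S I :=
  Algebra.subset_adjoin ⟨i, hi, s, a, rfl⟩

theorem copies_le_allCopies (I : Set ℕ) (s : Side) : copies S I s ≤ allCopies S I :=
  Algebra.adjoin_mono fun _ ⟨i, hi, a, h⟩ => ⟨i, hi, s, a, h⟩

theorem mem_span_word {I : Set ℕ} {x : DotAlg S} (hx : x ∈ allCopies S I) :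
    x ∈ Submodule.span ℂ {x : DotAlg S | ∃ (n : ℕ) (χ : Fin n → Side) (ω : Fin n → ℕ)
      (a : ∀ j, S (χ j)), (∀ j, ω j ∈ I) ∧ x = word ω a} := by
  rw [allCopies, ← Subalgebra.mem_toSubmodule, Algebra.adjoin_eq_span] at hx
  refine Submodule.span_mono ?_ hx
  intro y hy
  induction hy using Submonoid.closure_induction_left with
  | one => exact ⟨0, Fin.elim0, Fin.elim0, fun j => j.elim0, fun j => j.elim0, by simp [word]⟩
  | mul_left x hx y _ ih =>
    obtain ⟨i, hi, s, b, rfl⟩ := hx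
    obtain ⟨n, χ, ω, a, hω, rfl⟩ := ih
    refine ⟨n + 1, Fin.cons s χ, Fin.cons i ω,
      Fin.cons (α := fun j => S ((Fin.cons s χ : Fin (n + 1) → Side) j)) b a, ?_, ?_⟩
    · intro j
      induction j using Fin.cases with
      | zero => exact hi
      | succ j => exact hω j
    · rw [word, word, List.ofFn_succ, List.prod_cons]
      rfl

theorem linearMap_eq_on_allCopies {M : Type*} [AddCommMonoid M] [Module ℂ M]
    {f g : DotAlg S →ₗ[ℂ] M} {I : Set ℕ}
    (h : ∀ (n : ℕ) (χ : Fin n → Side) (ω : Fin n → ℕ) (a : ∀ j, S (χ j)), (∀ j, ω j ∈ I) →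
      f (word ω a) = g (word ω a)) {x : DotAlg S} (hx : x ∈ allCopies S I) : f x = g x := by
  refine LinearMap.eqOn_span ?_ (mem_span_word hx)
  rintro _ ⟨n, χ, ω, a, hω, rfl⟩
  exact h n χ ω a hω

/-- The universal property gives a homomorphism into the generated subalgebra fixing the generators.
Followed by the inclusion, it is the identity. -/
theorem allCopies_univ : allCopies S Set.univ = ⊤ := by
  let f : DotAlg S →ₐ[ℂ] allCopies S Set.univ := dotLift fun i s =>
    { toFun := fun a => ⟨copyHom S i s a, copy_mem_allCopies (Set.mem_univ i) s a⟩
      map_smul' := fun c a => Subtype.ext (map_smul (copyHom S i s) c a)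
      map_zero' := Subtype.ext (map_zero (copyHom S i s))
      map_add' := fun a b => Subtype.ext (map_add (copyHom S i s) a b)
      map_mul' := fun a b => Subtype.ext (map_mul (copyHom S i s) a b) }
  have h : (allCopies S Set.univ).val.comp f = AlgHom.id ℂ _ := dotAlg_hom_ext fun i s a => by
    simp only [f, AlgHom.comp_apply, dotLift_copy]
    rfl
  refine eq_top_iff.2 fun x _ => ?_
  have := DFunLike.congr_fun h x
  rw [AlgHom.comp_apply, AlgHom.id_apply] at this
  rw [← this]
  exact (f x).2

end Enlarged

/-! ### The functionals of finitely many levels -/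

section Levels

variable {A : Type u} [NonUnitalRing A] [Module ℂ A] [IsScalarTower ℂ A A] [SMulCommClass ℂ A A]

theorem extend_one (φ : A →ₗ[ℂ] ℂ) : extend φ 1 = 1 := by
  simp [extend]

variable {S : Side → NonUnitalSubalgebra ℂ A} (φ : A →ₗ[ℂ] ℂ)

variable (S) in
/-- The action of the letters of one level. -/
def actHom (s : Side) : Unitization ℂ A →ₐ[ℂ]
    DotAlg S ⊗[ℂ] OpAlg (Unitization ℂ A) :=
  Algebra.TensorProduct.includeRight.comp (opAct s)

/-- The letters acting on one level and on the levels below. -/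
def levelLetter (M i : ℕ) (s : Side) :
    S s →ₙₐ[ℂ] DotAlg S ⊗[ℂ] OpAlg (Unitization ℂ A) :=
  if i < M then
    { toFun := fun a => copyHom S i s a ⊗ₜ opClose (extend φ) s
      map_smul' := fun c a => by rw [map_smul, TensorProduct.smul_tmul']; rfl
      map_zero' := by rw [map_zero, TensorProduct.zero_tmul]
      map_add' := fun a b => by rw [map_add, TensorProduct.add_tmul]
      map_mul' := fun a b => by
        rw [map_mul, Algebra.TensorProduct.tmul_mul_tmul, opClose_mul_self (extend_one φ)] }
  else if i = M then
    (actHom S s :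
      Unitization ℂ A →ₙₐ[ℂ] DotAlg S ⊗[ℂ] OpAlg (Unitization ℂ A)).comp
      ((Unitization.inrNonUnitalAlgHom ℂ A).comp (NonUnitalSubalgebraClass.subtype (S s)))
  -- This value plays no role: `productFun` evaluates `levelFun` only where all copies have index
  -- below the chosen level.
  else 0

/-- Separate the `M`-th level from the levels below. -/
def levelHom (M : ℕ) :
    DotAlg S →ₐ[ℂ] DotAlg S ⊗[ℂ] OpAlg (Unitization ℂ A) :=
  dotLift (levelLetter φ M)

theorem levelHom_copy_lt {M i : ℕ} (h : i < M) (s : Side) (a : S s) :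
    levelHom φ M (copy S i s a) = copy S i s a ⊗ₜ opClose (extend φ) s := by
  rw [levelHom, dotLift_copy, levelLetter, if_pos h]
  rfl

theorem levelHom_copy_self (M : ℕ) (s : Side) (a : S s) :
    levelHom φ M (copy S M s a) = 1 ⊗ₜ opAct s (Unitization.inr (a : A)) := by
  rw [levelHom, dotLift_copy, levelLetter, if_neg (lt_irrefl M), if_pos rfl]
  rfl

/-- The product of two functionals. -/
def tensorFun {B C : Type*} [AddCommGroup B] [Module ℂ B] [AddCommGroup C] [Module ℂ C]
    (f : B →ₗ[ℂ] ℂ) (g : C →ₗ[ℂ] ℂ) : B ⊗[ℂ] C →ₗ[ℂ] ℂ :=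
  TensorProduct.lift ((LinearMap.mul ℂ ℂ).compl₁₂ f g)

theorem tensorFun_tmul {B C : Type*} [AddCommGroup B] [Module ℂ B] [AddCommGroup C] [Module ℂ C]
    (f : B →ₗ[ℂ] ℂ) (g : C →ₗ[ℂ] ℂ) (x : B) (y : C) : tensorFun f g (x ⊗ₜ y) = f x * g y := by
  simp [tensorFun]

/-- The product functional of the levels below `M`. -/
def levelFun : ℕ → DotAlg S →ₗ[ℂ] ℂ
  | 0 => (delta S).toLinearMap
  | M + 1 => tensorFun (levelFun M) (opState (extend φ)) ∘ₗ (levelHom φ M).toLinearMap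

theorem prod_ofFn_tmul {B C : Type*} [Ring B] [Algebra ℂ B] [Ring C] [Algebra ℂ C] {n : ℕ}
    (x : Fin n → B) (y : Fin n → C) :
    (List.ofFn fun j => x j ⊗ₜ[ℂ] y j).prod = (List.ofFn x).prod ⊗ₜ (List.ofFn y).prod := by
  induction n with
  | zero => simp [Algebra.TensorProduct.one_def]
  | succ n ih => simp [List.ofFn_succ, ih]

theorem map_prod_ofFn {F M N : Type*} [Monoid M] [Monoid N] [FunLike F M N] [MonoidHomClass F M N]
    (f : F) {n : ℕ} (x : Fin n → M) :
    f (List.ofFn x).prod = (List.ofFn fun j => f (x j)).prod := by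
  rw [map_list_prod, List.map_ofFn]
  rfl

/-- The part of a word in the positions of `V`. -/
def subWord {n : ℕ} (V : Finset (Fin n)) (ω : Fin n → ℕ) {χ : Fin n → Side}
    (a : ∀ j, S (χ j)) : DotAlg S :=
  (List.ofFn fun j => if j ∈ V then copy S (ω j) (χ j) (a j) else 1).prod

/-- `levelHom` splits a word into its part below level `M`, treated by induction, tensored with a
word of operators whose separators are exactly those lower letters, evaluated by `opState_prod`. -/
theorem levelFun_subWord {n : ℕ} (χ : Fin n → Side) (ω : Fin n → ℕ) (a : ∀ j, S (χ j)) (M : ℕ)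
    (V : Finset (Fin n)) (hV : ∀ j ∈ V, ω j < M) :
    levelFun φ M (subWord V ω a) = ∏ m ∈ Finset.range M,
      ∏ U ∈ sepBlocks (chiLE χ) (V.filter fun j => ω j < m) (V.filter fun j => ω j = m),
        extend φ (blockProd (fun j => (Unitization.inr (a j : A) : Unitization ℂ A)) U) := by
  induction M generalizing V with
  | zero =>
    have : V = ∅ := Finset.eq_empty_of_forall_notMem fun j hj => Nat.not_lt_zero _ (hV j hj)
    subst this
    simp [subWord, levelFun]
  | succ M ih =>
    have h1 : levelHom φ M (subWord V ω a) =
        subWord (V.filter fun j => ω j < M) ω a ⊗ₜ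
        (List.ofFn (opLetter (extend φ) χ (fun j => Unitization.inr (a j : A))
          (V.filter fun j => ω j < M) (V.filter fun j => ω j = M))).prod := by
      rw [subWord, subWord, ← prod_ofFn_tmul, map_prod_ofFn]
      congr 2
      funext j
      by_cases hj : j ∈ V
      · rcases Nat.lt_succ_iff_lt_or_eq.1 (hV j hj) with h | h
        · simp [hj, h, levelHom_copy_lt, opLetter]
        · rw [h]
          simp [hj, h, levelHom_copy_self, opLetter]
      · simp [hj, opLetter, Algebra.TensorProduct.one_def]
    have h2 : ∀ m ≤ M, (V.filter fun j => ω j < M).filter (fun j => ω j < m) =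
        V.filter fun j => ω j < m := by
      intro m hm
      ext j
      simp only [Finset.mem_filter]
      exact ⟨fun h => ⟨h.1.1, h.2⟩, fun h => ⟨⟨h.1, h.2.trans_le hm⟩, h.2⟩⟩
    have h3 : ∀ m < M, (V.filter fun j => ω j < M).filter (fun j => ω j = m) =
        V.filter fun j => ω j = m := by
      intro m hm
      ext j
      simp only [Finset.mem_filter]
      exact ⟨fun h => ⟨h.1.1, h.2⟩, fun h => ⟨⟨h.1, h.2.trans_lt hm⟩, h.2⟩⟩
    rw [levelFun, LinearMap.comp_apply, AlgHom.toLinearMap_apply, h1, tensorFun_tmul,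
      ih _ fun j hj => (Finset.mem_filter.1 hj).2, opState_prod (extend_one φ),
      Finset.prod_range_succ]
    · congr 1
      refine Finset.prod_congr rfl fun m hm => ?_
      rw [h2 m (Finset.mem_range.1 hm).le, h3 m (Finset.mem_range.1 hm)]
    · exact Finset.disjoint_filter.2 fun j _ h h' => absurd h' h.ne

theorem subWord_univ {n : ℕ} (ω : Fin n → ℕ) {χ : Fin n → Side} (a : ∀ j, S (χ j)) :
    subWord Finset.univ ω a = word ω a := by
  simp [subWord, word]

/-- A level without letters has no blocks and contributes an empty product. This consistency allows
the levels to be glued into `productFun`. -/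
theorem levelFun_succ_subWord {n : ℕ} (χ : Fin n → Side) (ω : Fin n → ℕ) (a : ∀ j, S (χ j))
    (M : ℕ) (V : Finset (Fin n)) (hV : ∀ j ∈ V, ω j < M) :
    levelFun φ (M + 1) (subWord V ω a) = levelFun φ M (subWord V ω a) := by
  rw [levelFun_subWord φ χ ω a (M + 1) V fun j hj => (hV j hj).trans (Nat.lt_succ_self M),
    levelFun_subWord φ χ ω a M V hV, Finset.prod_range_succ,
    Finset.filter_false_of_mem fun j hj => (hV j hj).ne]
  simp [sepBlocks]

theorem levelFun_eq_of_le {M N : ℕ} (h : M ≤ N) {x : DotAlg S}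
    (hx : x ∈ allCopies S (Set.Iio M)) : levelFun φ N x = levelFun φ M x := by
  induction N, h using Nat.le_induction with
  | base => rfl
  | succ N hN ih =>
    rw [← ih]
    refine linearMap_eq_on_allCopies (I := Set.Iio M) (fun n χ ω a hω => ?_) hx
    rw [← subWord_univ]
    exact levelFun_succ_subWord φ χ ω a N _ fun j _ => lt_of_lt_of_le (hω j) hN

theorem allCopies_mono {I J : Set ℕ} (h : I ⊆ J) : allCopies S I ≤ allCopies S J :=
  Algebra.adjoin_mono fun _ ⟨i, hi, hx⟩ => ⟨i, h hi, hx⟩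

theorem exists_mem_allCopies (x : DotAlg S) : ∃ M, x ∈ allCopies S (Set.Iio M) := by
  have hx : x ∈ allCopies S Set.univ := by rw [allCopies_univ]; trivial
  induction hx using Algebra.adjoin_induction with
  | mem x h =>
    obtain ⟨i, -, s, a, rfl⟩ := h
    exact ⟨i + 1, copy_mem_allCopies (Set.mem_Iio.2 (Nat.lt_succ_self i)) s a⟩
  | algebraMap r => exact ⟨0, Subalgebra.algebraMap_mem _ r⟩
  | add x y _ _ hx hy =>
    obtain ⟨M, hM⟩ := hx
    obtain ⟨N, hN⟩ := hy
    have hx := allCopies_mono (Set.Iio_subset_Iio (le_max_left M N)) hM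
    have hy := allCopies_mono (Set.Iio_subset_Iio (le_max_right M N)) hN
    exact ⟨max M N, (allCopies S _).add_mem hx hy⟩
  | mul x y _ _ hx hy =>
    obtain ⟨M, hM⟩ := hx
    obtain ⟨N, hN⟩ := hy
    have hx := allCopies_mono (Set.Iio_subset_Iio (le_max_left M N)) hM
    have hy := allCopies_mono (Set.Iio_subset_Iio (le_max_right M N)) hN
    exact ⟨max M N, (allCopies S _).mul_mem hx hy⟩

theorem levelFun_choose {M : ℕ} {x : DotAlg S} (hx : x ∈ allCopies S (Set.Iio M)) :
    levelFun φ (exists_mem_allCopies x).choose x = levelFun φ M x := by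
  rcases le_total M (exists_mem_allCopies x).choose with h | h
  · exact levelFun_eq_of_le φ h hx
  · exact (levelFun_eq_of_le φ h (exists_mem_allCopies x).choose_spec).symm

/-- The bi-monotonic product functional. -/
def productFun : DotAlg S →ₗ[ℂ] ℂ where
  toFun x := levelFun φ (exists_mem_allCopies x).choose x
  map_add' x y := by
    obtain ⟨M, hM⟩ := exists_mem_allCopies x
    obtain ⟨N, hN⟩ := exists_mem_allCopies y
    have hx := allCopies_mono (Set.Iio_subset_Iio (le_max_left M N)) hM
    have hy := allCopies_mono (Set.Iio_subset_Iio (le_max_right M N)) hN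
    rw [levelFun_choose φ hx, levelFun_choose φ hy, levelFun_choose φ (add_mem hx hy), map_add]
  map_smul' c x := by
    obtain ⟨M, hM⟩ := exists_mem_allCopies x
    rw [levelFun_choose φ hM, levelFun_choose φ (Subalgebra.smul_mem _ hM c), map_smul]
    rfl

theorem productFun_eq {M : ℕ} {x : DotAlg S} (hx : x ∈ allCopies S (Set.Iio M)) :
    productFun φ x = levelFun φ M x :=
  levelFun_choose φ hx

end Levels

/-! ### Nested blocks and the moments of words -/

section Nested

variable {n : ℕ} (χ : Fin n → Side)

/-- The block of `j` in `V`: the elements of the same colour not separated from `j` by an element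
of `V` of lower colour. -/
def nestBlock (V : Finset (Fin n)) (ω : Fin n → ℕ) (j : Fin n) : Finset (Fin n) :=
  V.filter fun i => ω i = ω j ∧ ∀ k ∈ V, chiBetween χ i j k → ω j ≤ ω k

/-- The blocks of the word with positions in `V` and colours `ω`. -/
def nestBlocks (V : Finset (Fin n)) (ω : Fin n → ℕ) : Finset (Finset (Fin n)) :=
  V.image (nestBlock χ V ω)

theorem chiBetween_self_eq {i k : Fin n} (h : chiBetween χ i i k) : k = i := by
  rcases h with h | h <;> exact antisymm_of (chiLE χ) h.2 h.1

theorem mem_nestBlock_self {V : Finset (Fin n)} {ω : Fin n → ℕ} {j : Fin n} (hj : j ∈ V) :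
    j ∈ nestBlock χ V ω j :=
  Finset.mem_filter.2 ⟨hj, rfl, fun _ _ h => (chiBetween_self_eq χ h ▸ le_rfl)⟩

theorem sepBlock_filter_eq_nestBlock (V : Finset (Fin n)) (ω : Fin n → ℕ) {m : ℕ} {j : Fin n}
    (hj : ω j = m) :
    sepBlock (chiLE χ) (V.filter fun j => ω j < m) (V.filter fun j => ω j = m) j =
      nestBlock χ V ω j := by
  ext i
  rw [mem_sepBlock, nestBlock, Finset.mem_filter, Finset.mem_filter, hj, and_assoc]
  refine and_congr_right fun _ => and_congr_right fun _ => forall_congr' fun _ => ?_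
  rw [Finset.mem_filter, and_imp]
  refine forall_congr' fun _ => ?_
  rw [← not_lt, imp_not_comm]
  rfl

theorem nestBlocks_eq_biUnion (V : Finset (Fin n)) (ω : Fin n → ℕ) {M : ℕ}
    (hM : ∀ j ∈ V, ω j < M) :
    nestBlocks χ V ω = (Finset.range M).biUnion fun m =>
      sepBlocks (chiLE χ) (V.filter fun j => ω j < m) (V.filter fun j => ω j = m) := by
  ext U
  simp only [nestBlocks, sepBlocks, Finset.mem_biUnion, Finset.mem_image, Finset.mem_range,
    Finset.mem_filter]
  constructor
  · rintro ⟨j, hj, rfl⟩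
    exact ⟨ω j, hM j hj, j, ⟨hj, rfl⟩, sepBlock_filter_eq_nestBlock χ V ω rfl⟩
  · rintro ⟨m, -, j, ⟨hj, hjm⟩, rfl⟩
    exact ⟨j, hj, (sepBlock_filter_eq_nestBlock χ V ω hjm).symm⟩

variable {χ} {A : Type u} [NonUnitalRing A] [Module ℂ A] [IsScalarTower ℂ A A]
  [SMulCommClass ℂ A A] {S : Side → NonUnitalSubalgebra ℂ A} (φ : A →ₗ[ℂ] ℂ)

/-- The moment `φ(a_V)`. -/
def subMoment (a : ∀ j, S (χ j)) (V : Finset (Fin n)) : ℂ :=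
  extend φ (blockProd (fun j => (Unitization.inr (a j : A) : Unitization ℂ A)) V)

theorem subWord_mem (V : Finset (Fin n)) (ω : Fin n → ℕ) (a : ∀ j, S (χ j)) {I : Set ℕ}
    (hI : ∀ j ∈ V, ω j ∈ I) : subWord V ω a ∈ allCopies S I := by
  refine list_prod_mem fun x hx => ?_
  obtain ⟨j, rfl⟩ := (List.mem_ofFn' _ _).1 hx
  dsimp only
  split_ifs with h
  · exact copy_mem_allCopies (hI j h) _ _
  · exact one_mem _

/-- The moments of words are products of the moments over the nested blocks. -/
theorem productFun_subWord (V : Finset (Fin n)) (ω : Fin n → ℕ) (a : ∀ j, S (χ j)) :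
    productFun φ (subWord V ω a) = ∏ U ∈ nestBlocks χ V ω, subMoment φ a U := by
  have hM : ∀ j ∈ V, ω j < Finset.univ.sup ω + 1 := fun j _ =>
    Nat.lt_succ_of_le (Finset.le_sup (Finset.mem_univ j))
  rw [productFun_eq φ (subWord_mem V ω a hM), levelFun_subWord φ χ ω a _ V hM,
    nestBlocks_eq_biUnion χ V ω hM, Finset.prod_biUnion]
  · rfl
  · intro m _ m' _ hmm
    refine Finset.disjoint_left.2 fun U hU hU' => ?_
    have hd : Disjoint (V.filter fun j => ω j < m) (V.filter fun j => ω j = m) :=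
      Finset.disjoint_filter.2 fun j _ h h' => absurd h' h.ne
    rcases Finset.eq_empty_or_nonempty U with rfl | ⟨j, hj⟩
    · exact empty_notMem_sepBlocks (chiLE χ) hd hU
    · exact hmm ((Finset.mem_filter.1 (subset_of_mem_sepBlocks _ hU hj)).2.symm.trans
        (Finset.mem_filter.1 (subset_of_mem_sepBlocks _ hU' hj)).2)

end Nested

/-! ### Blocks of `π_{χ, ω}` -/

section ChiBlocks

variable {n : ℕ} {χ : Fin n → Side} {κ : Type*} [DecidableEq κ] {ω : Fin n → κ}

theorem mem_chiBlock {i j : Fin n} :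
    i ∈ chiBlock χ ω j ↔ ∀ k, chiBetween χ i j k → ω k = ω j := by
  simp [chiBlock]

theorem chiBetween_left (i j : Fin n) : chiBetween χ i j i := by
  rcases total_of (chiLE χ) i j with h | h
  · exact Or.inl ⟨refl_of _ _, h⟩
  · exact Or.inr ⟨h, refl_of _ _⟩

theorem chiBetween_symm {i j k : Fin n} (h : chiBetween χ i j k) : chiBetween χ j i k :=
  Or.symm h

theorem chiBetween_cases {i j k l : Fin n} (h : chiBetween χ i j k) :
    chiBetween χ i l k ∨ chiBetween χ l j k := by
  rcases h with h | h
  · rcases total_of (chiLE χ) k l with hl | hl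
    · exact Or.inl (Or.inl ⟨h.1, hl⟩)
    · exact Or.inr (Or.inl ⟨hl, h.2⟩)
  · rcases total_of (chiLE χ) k l with hl | hl
    · exact Or.inr (Or.inr ⟨h.1, hl⟩)
    · exact Or.inl (Or.inr ⟨hl, h.2⟩)

theorem mem_chiBlock_self (j : Fin n) : j ∈ chiBlock χ ω j :=
  mem_chiBlock.2 fun _ h => by rw [chiBetween_self_eq χ h]

theorem eq_of_mem_chiBlock {i j : Fin n} (h : i ∈ chiBlock χ ω j) : ω i = ω j :=
  mem_chiBlock.1 h i (chiBetween_left i j)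

theorem mem_chiBlock_symm {i j : Fin n} (h : i ∈ chiBlock χ ω j) : j ∈ chiBlock χ ω i :=
  mem_chiBlock.2 fun k hk =>
    (mem_chiBlock.1 h k (chiBetween_symm hk)).trans (eq_of_mem_chiBlock h).symm

theorem mem_chiBlock_trans {i j l : Fin n} (h : i ∈ chiBlock χ ω j) (h' : j ∈ chiBlock χ ω l) :
    i ∈ chiBlock χ ω l := by
  refine mem_chiBlock.2 fun k hk => ?_
  rcases chiBetween_cases (l := j) hk with hk | hk
  · exact (mem_chiBlock.1 h k hk).trans (eq_of_mem_chiBlock h')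
  · exact mem_chiBlock.1 h' k hk

theorem chiBlock_eq_of_mem {i j : Fin n} (h : i ∈ chiBlock χ ω j) :
    chiBlock χ ω i = chiBlock χ ω j :=
  Finset.ext fun _ => ⟨fun h' => mem_chiBlock_trans h' h,
    fun h' => mem_chiBlock_trans h' (mem_chiBlock_symm h)⟩

theorem chiBlock_const {j : Fin n} (h : ∀ i, ω i = ω j) : chiBlock χ ω j = Finset.univ :=
  Finset.eq_univ_of_forall fun _ => mem_chiBlock.2 fun k _ => h k

theorem chiPartition_const (hn : 1 ≤ n) {c : κ} (h : ∀ i, ω i = c) :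
    chiPartition χ ω = {Finset.univ} := by
  have : Nonempty (Fin n) := ⟨⟨0, hn⟩⟩
  ext V
  simp only [chiPartition, Finset.mem_image, Finset.mem_univ, true_and, Finset.mem_singleton]
  refine ⟨?_, ?_⟩
  · rintro ⟨j, rfl⟩
    exact chiBlock_const fun i => (h i).trans (h j).symm
  · rintro rfl
    obtain ⟨j⟩ := this
    exact ⟨j, chiBlock_const fun i => (h i).trans (h j).symm⟩

/-- The block of `k` is an interval containing neither `i` nor `j`, so it lies between them as a
whole as soon as `k` does. -/
theorem chiBetween_of_mem_chiBlock {i j k e : Fin n} (hk : chiBetween χ i j k)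
    (he : e ∈ chiBlock χ ω k) (hi : ω i ≠ ω k) (hj : ω j ≠ ω k) : chiBetween χ i j e := by
  have hi' : ¬ chiBetween χ e k i := fun h => hi (mem_chiBlock.1 he i h)
  have hj' : ¬ chiBetween χ e k j := fun h => hj (mem_chiBlock.1 he j h)
  simp only [chiBetween, not_or, not_and] at *
  rcases hk with hk | hk
  · refine Or.inl ⟨(total_of _ i e).resolve_right fun h => hi'.1 h hk.1,
      (total_of _ e j).resolve_right fun h => hj'.2 hk.2 h⟩
  · refine Or.inr ⟨(total_of _ j e).resolve_right fun h => hj'.1 h hk.1,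
      (total_of _ e i).resolve_right fun h => hi'.2 hk.2 h⟩

end ChiBlocks

/-- One separator in each interval of colour `0` cuts as much as all letters of colour `0` together.
-/
theorem sepBlock_eq_chiBlock {n : ℕ} {χ : Fin n → Side} {ω : Fin n → Fin 2} {E : Finset (Fin n)}
    (hE : ∀ e ∈ E, ω e = 0) (hhit : ∀ k, ω k = 0 → ∃ e ∈ E, e ∈ chiBlock χ ω k) {j : Fin n}
    (hj : ω j = 1) :
    sepBlock (chiLE χ) E (Finset.univ.filter fun j => ω j = 1) j = chiBlock χ ω j := by
  ext i
  rw [mem_sepBlock, Finset.mem_filter, mem_chiBlock, hj]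
  constructor
  · rintro ⟨⟨-, hi⟩, h⟩ k hk
    by_contra hk1
    have hk0 : ω k = 0 := by omega
    obtain ⟨e, he, hek⟩ := hhit k hk0
    exact h e he (chiBetween_of_mem_chiBlock hk hek (by simp [hi, hk0]) (by simp [hj, hk0]))
  · intro h
    refine ⟨⟨Finset.mem_univ _, h i (chiBetween_left i j)⟩, fun k hk hb => ?_⟩
    have := (h k hb).symm.trans (hE k hk)
    simp at this

/-! ### Existence of the bi-monotonic product -/

section Existence

variable {A : Type u} [NonUnitalRing A] [Module ℂ A] [IsScalarTower ℂ A A] [SMulCommClass ℂ A A]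
variable {S : Side → NonUnitalSubalgebra ℂ A} (φ : A →ₗ[ℂ] ℂ)

theorem moment_eq_subMoment {n : ℕ} {χ : Fin n → Side} (a : ∀ j, S (χ j)) :
    (moment φ fun j => (a j : A)) = subMoment φ a Finset.univ := by
  rw [subMoment, blockProd_univ, moment]

theorem productFun_one : productFun φ (1 : DotAlg S) = 1 := by
  have h := productFun_subWord φ (S := S) (χ := Fin.elim0) ∅ Fin.elim0 fun j => j.elim0
  simpa [subWord, nestBlocks] using h

theorem levelFun_one (M : ℕ) : levelFun φ M (1 : DotAlg S) = 1 := by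
  rw [← productFun_eq φ (one_mem (allCopies S (Set.Iio M))), productFun_one]

theorem productFun_word {n : ℕ} {χ : Fin n → Side} (ω : Fin n → ℕ) (a : ∀ j, S (χ j)) :
    productFun φ (word ω a) = ∏ U ∈ nestBlocks χ Finset.univ ω, subMoment φ a U := by
  rw [← subWord_univ, productFun_subWord]

theorem nestBlocks_const {n : ℕ} (χ : Fin n → Side) (hn : 1 ≤ n) (i : ℕ) :
    nestBlocks χ Finset.univ (fun _ => i) = {Finset.univ} := by
  have : Nonempty (Fin n) := ⟨⟨0, hn⟩⟩
  have h : nestBlock χ Finset.univ (fun _ => i) = fun _ => Finset.univ := by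
    funext j
    simp [nestBlock]
  rw [nestBlocks, h, Finset.image_const Finset.univ_nonempty]

theorem productFun_restrict (i n : ℕ) (χ : Fin n → Side) (a : ∀ j, S (χ j)) :
    productFun φ (List.ofFn fun j => copy S i (χ j) (a j)).prod =
      moment φ fun j => (a j : A) := by
  have h := productFun_word φ (fun _ => i) a
  rw [word] at h
  rw [h, moment_eq_subMoment]
  rcases Nat.eq_zero_or_pos n with rfl | hn
  · simp [nestBlocks, subMoment, blockProd_empty, extend_one]
  · rw [nestBlocks_const χ hn, Finset.prod_singleton]

/-- By idempotence of `opClose`, a nonempty product of lower letters of one side still carries a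
single `opClose`, while scalars carry `1`; `δ` extracts the scalar part. -/
theorem levelHom_of_mem_lt {m : ℕ} {s : Side} {x : DotAlg S} (hx : x ∈ copies S (Set.Iio m) s) :
    levelHom φ m x = (x - algebraMap ℂ _ (delta S x)) ⊗ₜ opClose (extend φ) s +
      algebraMap ℂ _ (delta S x) ⊗ₜ 1 := by
  induction hx using Algebra.adjoin_induction with
  | mem x h =>
    obtain ⟨i, hi, a, rfl⟩ := h
    rw [levelHom_copy_lt φ hi, delta_copy]
    simp
  | algebraMap r =>
    rw [AlgHom.commutes, AlgHom.commutes, Algebra.algebraMap_self_apply, sub_self,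
      TensorProduct.zero_tmul, zero_add]
    rfl
  | add x y _ _ hx hy =>
    rw [map_add, hx, hy, map_add, map_add, add_sub_add_comm, TensorProduct.add_tmul,
      TensorProduct.add_tmul]
    abel
  | mul x y _ _ hx hy =>
    rw [map_mul, hx, hy, map_mul, map_mul]
    generalize algebraMap ℂ (DotAlg S) (delta S x) = p
    generalize algebraMap ℂ (DotAlg S) (delta S y) = q
    simp only [mul_add, add_mul, Algebra.TensorProduct.tmul_mul_tmul, one_mul, mul_one,
      opClose_mul_self (extend_one φ)]
    rw [← add_assoc, ← TensorProduct.add_tmul, ← TensorProduct.add_tmul]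
    congr 2
    noncomm_ring

theorem levelHom_of_mem_self {m : ℕ} {s : Side} {x : DotAlg S} (hx : x ∈ copies S {m} s) :
    ∃ y : Unitization ℂ A, levelHom φ m x = 1 ⊗ₜ opAct s y := by
  induction hx using Algebra.adjoin_induction with
  | mem x h =>
    obtain ⟨i, rfl, a, rfl⟩ := h
    exact ⟨_, levelHom_copy_self φ _ s a⟩
  | algebraMap r =>
    refine ⟨algebraMap ℂ _ r, ?_⟩
    rw [AlgHom.commutes, AlgHom.commutes, Algebra.TensorProduct.algebraMap_apply,
      Algebra.algebraMap_eq_smul_one, Algebra.algebraMap_eq_smul_one, TensorProduct.smul_tmul]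
  | add x y _ _ hx hy =>
    obtain ⟨x', hx⟩ := hx
    obtain ⟨y', hy⟩ := hy
    exact ⟨x' + y', by rw [map_add, hx, hy, map_add, TensorProduct.tmul_add]⟩
  | mul x y _ _ hx hy =>
    obtain ⟨x', hx⟩ := hx
    obtain ⟨y', hy⟩ := hy
    exact ⟨x' * y', by
      rw [map_mul, hx, hy, map_mul, Algebra.TensorProduct.tmul_mul_tmul, one_mul]⟩

theorem opState_prod_joined {R : Type u} [Ring R] [Algebra ℂ R] (ψ : R →ₗ[ℂ] ℂ) (h1 : ψ 1 = 1)
    {n : ℕ} (χ : Fin n → Side) (y : Fin n → R) (V : Finset (Fin n)) :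
    opState ψ (List.ofFn fun j => if j ∈ V then opAct (χ j) (y j) else 1).prod =
      ψ (blockProd y V) := by
  have h := opState_prod (χ := χ) (b := y) h1 ∅ V (Finset.disjoint_empty_left V)
  have h2 : opLetter ψ χ y ∅ V = fun j => if j ∈ V then opAct (χ j) (y j) else 1 := by
    funext j
    simp [opLetter]
  rw [h2] at h
  rw [h]
  rcases Finset.eq_empty_or_nonempty V with rfl | ⟨j, hj⟩
  · simp [sepBlocks, blockProd_empty, h1]
  · rw [(Finset.subset_singleton_iff.1 (sepBlocks_empty_subset (chiLE χ) V)).resolve_left,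
      Finset.prod_singleton]
    exact Finset.ne_empty_of_mem (Finset.mem_image_of_mem _ hj)

theorem blockProd_mem {B : Type*} [Ring B] [Algebra ℂ B] {n : ℕ} {b : Fin n → B}
    {V : Finset (Fin n)} {T : Subalgebra ℂ B} (h : ∀ j ∈ V, b j ∈ T) : blockProd b V ∈ T := by
  rw [blockProd_eq]
  refine list_prod_mem fun x hx => ?_
  obtain ⟨j, rfl⟩ := (List.mem_ofFn' _ _).1 hx
  dsimp only
  split_ifs with hj
  · exact h j hj
  · exact one_mem _

theorem copies_le_sup (I : Set ℕ) (s : Side) :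
    copies S I s ≤ copies S I Side.left ⊔ copies S I Side.right := by
  cases s
  · exact le_sup_left
  · exact le_sup_right

theorem sup_copies_le (I : Set ℕ) :
    copies S I Side.left ⊔ copies S I Side.right ≤ allCopies S I :=
  sup_le (copies_le_allCopies I _) (copies_le_allCopies I _)

theorem map_blockProd {B C : Type*} [Ring B] [Algebra ℂ B] [Semiring C] [Algebra ℂ C]
    (f : B →ₐ[ℂ] C) {n : ℕ} (b : Fin n → B) (V : Finset (Fin n)) :
    f (blockProd b V) = (List.ofFn fun j => if j ∈ V then f (b j) else 1).prod := by
  rw [blockProd_eq, map_prod_ofFn]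
  congr 2
  funext j
  split_ifs <;> simp

theorem exists_delta_eq_zero {n : ℕ} {b : Fin n → DotAlg S} {V : Finset (Fin n)}
    (h : delta S (blockProd b V) = 0) : ∃ j ∈ V, delta S (b j) = 0 := by
  rw [map_blockProd, List.prod_ofFn, Finset.prod_eq_zero_iff] at h
  obtain ⟨j, -, hj⟩ := h
  by_cases hV : j ∈ V
  · exact ⟨j, hV, by simpa [hV] using hj⟩
  · simp [hV] at hj

theorem delta_blockProd_eq_zero {n : ℕ} {b : Fin n → DotAlg S} {V : Finset (Fin n)} {j : Fin n}
    (hj : j ∈ V) (h : delta S (b j) = 0) : delta S (blockProd b V) = 0 := by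
  rw [map_blockProd, List.prod_ofFn]
  exact Finset.prod_eq_zero (Finset.mem_univ j) (by simp [hj, h])

/-- The product functional vanishes on centred words. -/
theorem productFun_eq_zero_of_centred {m n : ℕ} {χ : Fin n → Side} {ω : Fin n → Fin 2}
    {b : Fin n → DotAlg S} (hb0 : ∀ j, ω j = 0 → b j ∈ copies S (Set.Iio m) (χ j))
    (hb1 : ∀ j, ω j = 1 → b j ∈ copies S {m} (χ j))
    (h0 : ∀ j, ω j = 0 → delta S (blockProd b (chiBlock χ ω j)) = 0)
    {j₀ : Fin n} (hj₀ : ω j₀ = 1) (h1 : productFun φ (blockProd b (chiBlock χ ω j₀)) = 0) :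
    productFun φ (List.ofFn b).prod = 0 := by
  have hlt : Set.Iio m ⊆ Set.Iio (m + 1) := Set.Iio_subset_Iio (Nat.le_succ m)
  have hself : ({m} : Set ℕ) ⊆ Set.Iio (m + 1) := by simp
  have hall : ∀ j, b j ∈ allCopies S (Set.Iio (m + 1)) := by
    intro j
    rcases Fin.exists_fin_two.1 ⟨ω j, rfl⟩ with h | h
    · exact allCopies_mono hlt (copies_le_allCopies _ _ (hb0 j h))
    · exact allCopies_mono hself (copies_le_allCopies _ _ (hb1 j h))
  have hy : ∀ j, ∃ y : Unitization ℂ A, ω j = 1 → levelHom φ m (b j) = 1 ⊗ₜ opAct (χ j) y := by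
    intro j
    by_cases h : ω j = 1
    · obtain ⟨y, hy⟩ := levelHom_of_mem_self φ (hb1 j h)
      exact ⟨y, fun _ => hy⟩
    · exact ⟨0, fun h' => absurd h' h⟩
  choose y hy using hy
  -- The block of `j₀` contains only letters of level `m`, so its moment is computed in the joined
  -- state and the hypothesis becomes one on `φ`.
  have hψ : extend φ (blockProd y (chiBlock χ ω j₀)) = 0 := by
    rw [← h1, productFun_eq φ (blockProd_mem fun j _ => hall j), levelFun, LinearMap.comp_apply,
      AlgHom.toLinearMap_apply, map_blockProd,
      ← opState_prod_joined (extend φ) (extend_one φ) χ]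
    have : (fun j => if j ∈ chiBlock χ ω j₀ then levelHom φ m (b j) else 1) = fun j =>
        (1 : DotAlg S) ⊗ₜ[ℂ] (if j ∈ chiBlock χ ω j₀ then opAct (χ j) (y j) else 1) := by
      funext j
      split_ifs with hj
      · exact hy j ((eq_of_mem_chiBlock hj).trans hj₀)
      · exact Algebra.TensorProduct.one_def
    rw [this, prod_ofFn_tmul (fun _ => (1 : DotAlg S)), tensorFun_tmul]
    simp [levelFun_one]
  let p : Fin n → DotAlg S ⊗[ℂ] OpAlg (Unitization ℂ A) := fun j =>
    if ω j = 0 then (b j - algebraMap ℂ _ (delta S (b j))) ⊗ₜ opClose (extend φ) (χ j) else 0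
  let q : Fin n → DotAlg S ⊗[ℂ] OpAlg (Unitization ℂ A) := fun j =>
    if ω j = 0 then algebraMap ℂ _ (delta S (b j)) ⊗ₜ 1 else 1 ⊗ₜ opAct (χ j) (y j)
  have hpq : (fun j => levelHom φ m (b j)) = p + q := by
    funext j
    by_cases h : ω j = 0
    · simp only [p, q, h, Pi.add_apply, if_true]
      exact levelHom_of_mem_lt φ (hb0 j h)
    · simp only [p, q, h, Pi.add_apply, if_false, zero_add]
      exact hy j (by omega)
  let F : MultilinearMap ℂ (fun _ : Fin n => DotAlg S ⊗[ℂ] OpAlg (Unitization ℂ A)) ℂ :=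
    (tensorFun (levelFun φ m) (opState (extend φ))).compMultilinearMap
      (MultilinearMap.mkPiAlgebraFin ℂ n _)
  have hF : ∀ x, F x = tensorFun (levelFun φ m) (opState (extend φ)) (List.ofFn x).prod :=
    fun x => by simp [F]
  rw [productFun_eq φ (list_prod_mem fun x hx => by
      obtain ⟨j, rfl⟩ := (List.mem_ofFn' _ _).1 hx; exact hall j), levelFun, LinearMap.comp_apply,
    AlgHom.toLinearMap_apply, map_prod_ofFn, ← hF, hpq, MultilinearMap.map_add_univ]
  -- `E` is the set of letters taken from `p`, that is, of those which separate.
  refine Finset.sum_eq_zero fun E _ => ?_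
  by_cases hE : ∀ e ∈ E, ω e = 0
  -- If `E` meets every interval of colour `0`, the block of `j₀` is one of the blocks cut out by
  -- `E` and contributes the factor zero.
  · by_cases hhit : ∀ k, ω k = 0 → ∃ e ∈ E, e ∈ chiBlock χ ω k
    · have hpw : E.piecewise p q = fun j =>
          (if ω j = 0 then if j ∈ E then b j - algebraMap ℂ _ (delta S (b j))
            else algebraMap ℂ _ (delta S (b j)) else 1) ⊗ₜ[ℂ]
          opLetter (extend φ) χ y E (Finset.univ.filter fun j => ω j = 1) j := by
        funext j
        by_cases h : ω j = 0
        · by_cases hj : j ∈ E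
          · simp [p, h, hj, opLetter]
          · simp [q, h, hj, opLetter]
        · have hj : j ∉ E := fun hj => h (hE j hj)
          have h' : ω j = 1 := by omega
          simp [q, hj, opLetter, h']
      have hd : Disjoint E (Finset.univ.filter fun j => ω j = 1) := by
        refine Finset.disjoint_left.2 fun e he he' => ?_
        have := (hE e he).symm.trans (Finset.mem_filter.1 he').2
        simp at this
      rw [hF, hpw, prod_ofFn_tmul, tensorFun_tmul, opState_prod (extend_one φ) _ _ hd]
      refine mul_eq_zero_of_right _ (Finset.prod_eq_zero (i := chiBlock χ ω j₀) ?_ hψ)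
      rw [← sepBlock_eq_chiBlock hE hhit hj₀]
      exact Finset.mem_image_of_mem _ (Finset.mem_filter.2 ⟨Finset.mem_univ _, hj₀⟩)
    -- An interval missed by `E` contributes only scalars `δ(b i)`. One of them is zero, because `δ`
    -- is multiplicative and vanishes on the product over the interval.
    · push Not at hhit
      obtain ⟨k, hk, hkE⟩ := hhit
      obtain ⟨i, hi, hi0⟩ := exists_delta_eq_zero (h0 k hk)
      have hiE : i ∉ E := fun h => hkE i h hi
      refine F.map_coord_zero i ?_
      rw [Finset.piecewise_eq_of_notMem _ _ _ hiE]
      simp [q, (eq_of_mem_chiBlock hi).trans hk, hi0]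
  · push Not at hE
    obtain ⟨e, he, he0⟩ := hE
    refine F.map_coord_zero e ?_
    rw [Finset.piecewise_eq_of_mem _ _ _ he]
    simp [p, he0]

/-- The projection onto the `m`-th copy. -/
def projHom (m : ℕ) : DotAlg S →ₐ[ℂ] DotAlg S :=
  dotLift fun i s => if i = m then copyHom S m s else 0

theorem projHom_of_mem_allCopies_lt {m : ℕ} {x : DotAlg S}
    (hx : x ∈ allCopies S (Set.Iio m)) : projHom m x = algebraMap ℂ _ (delta S x) := by
  have : allCopies S (Set.Iio m) ≤
      AlgHom.equalizer (projHom m) ((Algebra.ofId ℂ (DotAlg S)).comp (delta S)) := by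
    refine Algebra.adjoin_le ?_
    rintro _ ⟨i, hi, s, a, rfl⟩
    rw [SetLike.mem_coe, AlgHom.mem_equalizer, AlgHom.comp_apply, delta_copy, map_zero, projHom,
      dotLift_copy, if_neg (ne_of_lt hi)]
    rfl
  exact this hx

theorem projHom_of_mem_allCopies_self {m : ℕ} {x : DotAlg S} (hx : x ∈ allCopies S {m}) :
    projHom m x = x := by
  have : allCopies S {m} ≤ AlgHom.equalizer (projHom m) (AlgHom.id ℂ (DotAlg S)) := by
    refine Algebra.adjoin_le ?_
    rintro _ ⟨i, rfl, s, a, rfl⟩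
    rw [SetLike.mem_coe, AlgHom.mem_equalizer, AlgHom.id_apply, projHom, dotLift_copy, if_pos rfl]
    rfl
  exact this hx

theorem mem_of_eq_zero {T₁ T₂ : Side → Subalgebra ℂ (DotAlg S)} {n : ℕ} {χ : Fin n → Side}
    {ω : Fin n → Fin 2} {b : Fin n → DotAlg S}
    (hb : ∀ j, b j ∈ (![T₁, T₂] : Fin 2 → Side → Subalgebra ℂ (DotAlg S)) (ω j) (χ j)) {j : Fin n}
    (h : ω j = 0) : b j ∈ T₁ (χ j) := by
  have := hb j
  rw [h] at this
  exact this

theorem mem_of_eq_one {T₁ T₂ : Side → Subalgebra ℂ (DotAlg S)} {n : ℕ} {χ : Fin n → Side}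
    {ω : Fin n → Fin 2} {b : Fin n → DotAlg S}
    (hb : ∀ j, b j ∈ (![T₁, T₂] : Fin 2 → Side → Subalgebra ℂ (DotAlg S)) (ω j) (χ j)) {j : Fin n}
    (h : ω j = 1) : b j ∈ T₂ (χ j) := by
  have := hb j
  rw [h] at this
  exact this

/-- Take for `Ψ` the product functional after killing all copies but the `m`-th. Blocks of level `m`
are then centred for `Φ` as well, so both sides of the product formula vanish if such a block
exists; otherwise there is a single block. -/
theorem productFun_isBiMonotonicPair (m : ℕ) :
    IsBiMonotonicPair (delta S) (productFun φ) (copies S (Set.Iio m)) (copies S {m}) := by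
  have hΨ0 : ∀ x ∈ allCopies S (Set.Iio m), productFun φ (projHom m x) = delta S x := by
    intro x hx
    rw [projHom_of_mem_allCopies_lt hx, Algebra.algebraMap_eq_smul_one, map_smul, productFun_one,
      smul_eq_mul, mul_one]
  have hΨ1 : ∀ x ∈ allCopies S {m}, productFun φ (projHom m x) = productFun φ x := by
    intro x hx
    rw [projHom_of_mem_allCopies_self hx]
  refine ⟨productFun φ ∘ₗ (projHom m).toLinearMap, fun x hx => hΨ0 x (sup_copies_le _ hx),
    fun x hx => hΨ1 x (sup_copies_le _ hx), ?_⟩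
  intro n hn χ ω b hb hV
  have hb0 : ∀ j, ω j = 0 → b j ∈ copies S (Set.Iio m) (χ j) := fun j => mem_of_eq_zero hb
  have hb1 : ∀ j, ω j = 1 → b j ∈ copies S {m} (χ j) := fun j => mem_of_eq_one hb
  have hV0 : ∀ j, ω j = 0 → delta S (blockProd b (chiBlock χ ω j)) = 0 := by
    intro j hj
    rw [← hΨ0]
    · exact hV _ (Finset.mem_image_of_mem _ (Finset.mem_univ j))
    · exact blockProd_mem fun i hi =>
        copies_le_allCopies _ _ (hb0 i ((eq_of_mem_chiBlock hi).trans hj))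
  have hV1 : ∀ j, ω j = 1 → productFun φ (blockProd b (chiBlock χ ω j)) = 0 := by
    intro j hj
    rw [← hΨ1]
    · exact hV _ (Finset.mem_image_of_mem _ (Finset.mem_univ j))
    · exact blockProd_mem fun i hi =>
        copies_le_allCopies _ _ (hb1 i ((eq_of_mem_chiBlock hi).trans hj))
  constructor
  · by_cases h : ∃ j, ω j = 0
    · obtain ⟨j, hj⟩ := h
      obtain ⟨i, hi, hi0⟩ := exists_delta_eq_zero (hV0 j hj)
      have : projHom m (b i) = 0 := by
        rw [projHom_of_mem_allCopies_lt, hi0, map_zero]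
        exact copies_le_allCopies _ _ (hb0 i ((eq_of_mem_chiBlock hi).trans hj))
      rw [LinearMap.comp_apply, AlgHom.toLinearMap_apply, map_list_prod, List.map_ofFn,
        List.prod_eq_zero, map_zero]
      exact (List.mem_ofFn' _ _).2 ⟨i, this⟩
    · push Not at h
      have := hV Finset.univ (by
        rw [chiPartition_const hn (c := 1) fun i =>
          (Fin.exists_fin_two.1 ⟨ω i, rfl⟩).resolve_left (h i)]
        exact Finset.mem_singleton_self _)
      rwa [blockProd_univ] at this
  · by_cases h : ∃ j, ω j = 1
    · obtain ⟨j, hj⟩ := h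
      rw [productFun_eq_zero_of_centred φ hb0 hb1 hV0 hj (hV1 j hj)]
      exact (Finset.prod_eq_zero (i := chiBlock χ ω j)
        (Finset.mem_image_of_mem _ (Finset.mem_univ j)) (hV1 j hj)).symm
    · push Not at h
      rw [chiPartition_const hn (c := 0) fun i =>
        (Fin.exists_fin_two.1 ⟨ω i, rfl⟩).resolve_right (h i), Finset.prod_singleton,
        blockProd_univ]

theorem productFun_isBiMonotonicProduct : IsBiMonotonicProduct S φ (productFun φ) :=
  ⟨productFun_one φ, productFun_restrict φ, productFun_isBiMonotonicPair φ⟩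

end Existence

/-! ### Uniqueness of the bi-monotonic product -/

section Uniqueness

/-- Shifting all letters by `c` gives a polynomial in `c` with top coefficient `L 1`. For `L 1 = 1`
and a nonempty word it is monic of positive degree and has a complex root. -/
theorem exists_eval_prod_add {B : Type*} [Ring B] [Algebra ℂ B] (l : List B) (L : B →ₗ[ℂ] ℂ) :
    ∃ q : Polynomial ℂ, q.degree < l.length ∧
      ∀ c : ℂ, L (l.map fun x => x + algebraMap ℂ B c).prod = c ^ l.length * L 1 + q.eval c := by
  induction l generalizing L with
  | nil => exact ⟨0, by simp, by simp⟩
  | cons x l ih =>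
    obtain ⟨q, hq, h⟩ := ih L
    obtain ⟨q', hq', h'⟩ := ih (L ∘ₗ LinearMap.mulLeft ℂ x)
    refine ⟨Polynomial.C (L x) * Polynomial.X ^ l.length + q' + Polynomial.X * q, ?_, ?_⟩
    · rw [List.length_cons]
      have hlt : ((l.length : ℕ) : WithBot ℕ) < ((l.length + 1 : ℕ) : WithBot ℕ) := by
        exact_mod_cast Nat.lt_succ_self _
      refine (Polynomial.degree_add_le _ _).trans_lt (max_lt
        ((Polynomial.degree_add_le _ _).trans_lt (max_lt ?_ (hq'.trans hlt))) ?_)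
      · exact (Polynomial.degree_C_mul_X_pow_le _ _).trans_lt hlt
      · by_cases h0 : q = 0
        · simp [h0]
        · rw [mul_comm, Polynomial.degree_mul_X, Polynomial.degree_eq_natDegree h0]
          rw [Polynomial.degree_eq_natDegree h0] at hq
          exact_mod_cast Nat.succ_lt_succ (by exact_mod_cast hq)
    · intro c
      have h1 := h c
      have h2 := h' c
      rw [LinearMap.comp_apply, LinearMap.mulLeft_apply, LinearMap.comp_apply,
        LinearMap.mulLeft_apply, mul_one] at h2
      rw [List.map_cons, List.prod_cons, add_mul, map_add, h2, ← Algebra.smul_def, map_smul, h1]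
      simp only [Polynomial.eval_add, Polynomial.eval_mul, Polynomial.eval_C, Polynomial.eval_pow,
        Polynomial.eval_X, List.length_cons, smul_eq_mul]
      ring

/-- Letters can be centred by adding the same scalar to all of them. -/
theorem exists_centring {B : Type*} [Ring B] [Algebra ℂ B] (L : B →ₗ[ℂ] ℂ) (h1 : L 1 = 1)
    {n : ℕ} (b : Fin n → B) {V : Finset (Fin n)} (hV : V.Nonempty) :
    ∃ c : ℂ, L (blockProd (fun j => b j + algebraMap ℂ B c) V) = 0 := by
  obtain ⟨q, hq, h⟩ := exists_eval_prod_add (List.ofFn fun j => b (V.orderEmbOfFin rfl j)) L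
  rw [List.length_ofFn] at hq h
  have hm : (Polynomial.X ^ V.card + q).Monic := Polynomial.monic_X_pow_add hq
  have hd : (Polynomial.X ^ V.card + q).degree ≠ 0 := by
    rw [Polynomial.degree_add_eq_left_of_degree_lt (by rwa [Polynomial.degree_X_pow]),
      Polynomial.degree_X_pow]
    exact_mod_cast hV.card_ne_zero
  obtain ⟨c, hc⟩ := IsAlgClosed.exists_root _ hd
  refine ⟨c, ?_⟩
  have := h c
  rw [List.map_ofFn, h1, mul_one] at this
  rw [Polynomial.IsRoot, Polynomial.eval_add, Polynomial.eval_pow, Polynomial.eval_X] at hc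
  rw [← hc, ← this]
  rfl

theorem apply_eq_of_update {ι X Y : Type*} [Fintype ι] [DecidableEq ι] (g : (ι → X) → Y)
    (h : ∀ (x : ι → X) (j : ι) (c : X), g (Function.update x j c) = g x) (x y : ι → X) :
    g x = g y := by
  have : ∀ s : Finset ι, g (s.piecewise x y) = g y := by
    intro s
    induction s using Finset.induction_on with
    | empty => rw [Finset.piecewise_empty]
    | insert j s _ ih => rw [Finset.piecewise_insert, h, ih]
  simpa using this Finset.univ

variable {A : Type u} [NonUnitalRing A] [Module ℂ A] [IsScalarTower ℂ A A] [SMulCommClass ℂ A A]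
variable {S : Side → NonUnitalSubalgebra ℂ A} {φ : A →ₗ[ℂ] ℂ} {Φ Φ' : DotAlg S →ₗ[ℂ] ℂ}

theorem IsBiMonotonicProduct.eq_zero_of_centred (h : IsBiMonotonicProduct S φ Φ) {m n : ℕ}
    {χ : Fin n → Side} {ω : Fin n → Fin 2} {b : Fin n → DotAlg S}
    (hb0 : ∀ j, ω j = 0 → b j ∈ copies S (Set.Iio m) (χ j) ∧ delta S (b j) = 0)
    (hb1 : ∀ j, ω j = 1 → b j ∈ copies S {m} (χ j))
    (hV : ∀ j, ω j = 1 → Φ (blockProd b (chiBlock χ ω j)) = 0)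
    {j₀ : Fin n} (hj₀ : ω j₀ = 1) : Φ (List.ofFn b).prod = 0 := by
  obtain ⟨Ψ, hΨ0, hΨ1, hΨ⟩ := h.indep m
  rw [(hΨ n (Nat.one_le_of_lt j₀.2) χ ω b ?_ ?_).2]
  · exact Finset.prod_eq_zero (i := chiBlock χ ω j₀)
      (Finset.mem_image_of_mem _ (Finset.mem_univ j₀)) (hV j₀ hj₀)
  · intro j
    rcases Fin.exists_fin_two.1 ⟨ω j, rfl⟩ with hj | hj
    · have := (hb0 j hj).1
      rw [hj]
      exact this
    · have := hb1 j hj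
      rw [hj]
      exact this
  · intro V hVmem
    obtain ⟨j, -, rfl⟩ := Finset.mem_image.1 hVmem
    rcases Fin.exists_fin_two.1 ⟨ω j, rfl⟩ with hj | hj
    · rw [hΨ0]
      · exact delta_blockProd_eq_zero (mem_chiBlock_self j) (hb0 j hj).2
      · exact blockProd_mem fun i hi =>
          copies_le_sup _ _ (hb0 i ((eq_of_mem_chiBlock hi).trans hj)).1
    · rw [hΨ1]
      · exact hV j hj
      · exact blockProd_mem fun i hi =>
          copies_le_sup _ _ (hb1 i ((eq_of_mem_chiBlock hi).trans hj))

theorem IsBiMonotonicProduct.eq_on_self (h : IsBiMonotonicProduct S φ Φ)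
    (h' : IsBiMonotonicProduct S φ Φ') {m : ℕ} {x : DotAlg S} (hx : x ∈ allCopies S {m}) :
    Φ x = Φ' x := by
  refine linearMap_eq_on_allCopies (fun n χ ω a hω => ?_) hx
  have : ω = fun _ => m := funext fun j => hω j
  subst this
  rw [word, h.restrict, h'.restrict]

theorem prod_ofFn_update_one {M : Type*} [Monoid M] {n : ℕ} (b : Fin (n + 1) → M)
    (j : Fin (n + 1)) :
    (List.ofFn (Function.update b j 1)).prod = (List.ofFn fun i => b (j.succAbove i)).prod := by
  rw [← prod_ofFn_comp_orderEmb j.succAboveOrderEmb]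
  · simp
  · intro i hi
    have : i = j := by simpa using hi
    simp [this]

/-- Both functionals vanish on a word whose blocks of level `m` are centred, and by induction on the
length their difference does not notice the scalars added for centring. -/
theorem IsBiMonotonicProduct.eq_on_word (h : IsBiMonotonicProduct S φ Φ)
    (h' : IsBiMonotonicProduct S φ Φ') {m : ℕ}
    (hm : ∀ x ∈ allCopies S (Set.Iio m), Φ x = Φ' x) (n : ℕ)
    (χ : Fin n → Side) (ω : Fin n → Fin 2) (b : Fin n → DotAlg S)
    (hb0 : ∀ j, ω j = 0 → b j ∈ copies S (Set.Iio m) (χ j) ∧ delta S (b j) = 0)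
    (hb1 : ∀ j, ω j = 1 → b j ∈ copies S {m} (χ j)) :
    Φ (List.ofFn b).prod = Φ' (List.ofFn b).prod := by
  induction n with
  | zero => simp [h.map_one, h'.map_one]
  | succ n ih =>
    by_cases hω : ∃ j, ω j = 1
    swap
    · push Not at hω
      refine hm _ (list_prod_mem fun x hx => ?_)
      obtain ⟨j, rfl⟩ := (List.mem_ofFn' _ _).1 hx
      exact copies_le_allCopies _ _
        (hb0 j ((Fin.exists_fin_two.1 ⟨ω j, rfl⟩).resolve_right (hω j))).1
    obtain ⟨j₀, hj₀⟩ := hω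
    let D : MultilinearMap ℂ (fun _ : Fin (n + 1) => DotAlg S) ℂ :=
      (Φ - Φ').compMultilinearMap (MultilinearMap.mkPiAlgebraFin ℂ (n + 1) _)
    have hD : ∀ x, D x = Φ (List.ofFn x).prod - Φ' (List.ofFn x).prod := fun x => by simp [D]
    let s : (Fin (n + 1) → ℂ) → Fin (n + 1) → DotAlg S := fun c j =>
      if ω j = 1 then b j + algebraMap ℂ _ (c j) else b j
    have hs0 : ∀ c j, ω j = 0 → s c j ∈ copies S (Set.Iio m) (χ j) ∧ delta S (s c j) = 0 := by
      intro c j hj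
      simpa [s, hj] using hb0 j hj
    have hs1 : ∀ c j, ω j = 1 → s c j ∈ copies S {m} (χ j) := by
      intro c j hj
      simpa [s, hj] using add_mem (hb1 j hj) (Subalgebra.algebraMap_mem _ (c j))
    -- A letter replaced by `1` can be deleted, which leaves a shorter word.
    have hdel : ∀ c j, ω j = 1 → D (Function.update (s c) j 1) = 0 := by
      intro c j _
      rw [hD, prod_ofFn_update_one, sub_eq_zero]
      exact ih (fun i => χ (j.succAbove i)) (fun i => ω (j.succAbove i)) _
        (fun i hi => hs0 c _ hi) (fun i hi => hs1 c _ hi)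
    have hsu : ∀ c j (t : ℂ), ω j = 1 →
        s (Function.update c j t) = Function.update (s c) j (b j + t • 1) := by
      intro c j t hj
      funext i
      by_cases hi : i = j
      · subst hi; simp [s, hj, Algebra.algebraMap_eq_smul_one]
      · simp [s, hi]
    have hinv : ∀ c j (t : ℂ), D (s (Function.update c j t)) = D (s c) := by
      intro c j t
      by_cases hj : ω j = 1
      · have key : ∀ t : ℂ, D (s (Function.update c j t)) = D (Function.update (s c) j (b j)) := by
          intro t
          rw [hsu c j t hj, D.map_update_add, D.map_update_smul, hdel c j hj, smul_zero, add_zero]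
        rw [key t, ← key (c j), Function.update_eq_self]
      · congr 1
        funext i
        by_cases hi : i = j
        · subst hi; simp [s, hj]
        · simp [s, hi]
    choose r hr using fun V : {V : Finset (Fin (n + 1)) // V.Nonempty} =>
      exists_centring Φ h.map_one b V.2
    -- The shift depends only on the block of the letter, as `exists_centring` requires. The same
    -- shifts centre for `Φ'`, which agrees with `Φ` on the `m`-th copy.
    let c : Fin (n + 1) → ℂ := fun j => r ⟨chiBlock χ ω j, j, mem_chiBlock_self j⟩
    have hc : ∀ j, ω j = 1 → Φ (blockProd (s c) (chiBlock χ ω j)) = 0 := by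
      intro j hj
      rw [← hr ⟨chiBlock χ ω j, j, mem_chiBlock_self j⟩, blockProd_eq, blockProd_eq]
      congr 3
      funext i
      by_cases hi : i ∈ chiBlock χ ω j
      · have h1 := (eq_of_mem_chiBlock hi).trans hj
        have h2 : c i = c j := by simp only [c, chiBlock_eq_of_mem hi]
        simp [hi, s, h1, h2, c]
      · simp [hi]
    have hc' : ∀ j, ω j = 1 → Φ' (blockProd (s c) (chiBlock χ ω j)) = 0 := by
      intro j hj
      rw [← h.eq_on_self h' (m := m), hc j hj]
      exact blockProd_mem fun i hi =>
        copies_le_allCopies _ _ (hs1 c i ((eq_of_mem_chiBlock hi).trans hj))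
    have hDc : D (s c) = 0 := by
      rw [hD, h.eq_zero_of_centred (hs0 c) (hs1 c) hc hj₀,
        h'.eq_zero_of_centred (hs0 c) (hs1 c) hc' hj₀, sub_zero]
    have hb : s 0 = b := by
      funext j
      simp [s]
    rw [apply_eq_of_update (fun c => D (s c)) (fun c j t => hinv c j t) c 0, hb, hD] at hDc
    exact sub_eq_zero.1 hDc

theorem IsBiMonotonicProduct.unique (h : IsBiMonotonicProduct S φ Φ)
    (h' : IsBiMonotonicProduct S φ Φ') : Φ = Φ' := by
  have key : ∀ m : ℕ, ∀ x ∈ allCopies S (Set.Iio m), Φ x = Φ' x := by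
    intro m
    induction m with
    | zero =>
      intro x hx
      refine linearMap_eq_on_allCopies (fun n χ ω a hω => ?_) hx
      rcases Nat.eq_zero_or_pos n with rfl | hn
      · simp [word, h.map_one, h'.map_one]
      · exact absurd (hω ⟨0, hn⟩) (by simp)
    | succ m ih =>
      intro x hx
      refine linearMap_eq_on_allCopies (fun n χ ω a hω => ?_) hx
      -- The letters are generators, so the lower ones are already annihilated by `δ`.
      refine h.eq_on_word h' ih n χ (fun j => if ω j < m then 0 else 1) _ ?_ ?_
      · intro j hj
        have hlt : ω j < m := by by_contra hc; simp [hc] at hj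
        exact ⟨Algebra.subset_adjoin ⟨ω j, hlt, a j, rfl⟩, delta_copy _ _ _⟩
      · intro j hj
        have hlt : ¬ ω j < m := by intro hc; simp [hc] at hj
        have hlt' : ω j < m + 1 := hω j
        exact Algebra.subset_adjoin ⟨ω j, by simp; omega, a j, rfl⟩
  refine LinearMap.ext fun x => ?_
  obtain ⟨M, hM⟩ := exists_mem_allCopies x
  exact key M x hM

end Uniqueness

/-! ### Sums over colourings as polynomials -/

section Colourings

/-- The binomial coefficient `N choose k` as a polynomial in `N`. -/
def binomPoly (k : ℕ) : Polynomial ℂ :=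
  Polynomial.C ((k.factorial : ℂ)⁻¹) * descPochhammer ℂ k

theorem binomPoly_eval (k N : ℕ) : (binomPoly k).eval (N : ℂ) = N.choose k := by
  rw [binomPoly, Polynomial.eval_mul, Polynomial.eval_C, Nat.cast_choose_eq_descPochhammer_div,
    div_eq_inv_mul]

theorem binomPoly_coeff_zero {k : ℕ} (hk : k ≠ 0) : (binomPoly k).coeff 0 = 0 := by
  rw [Polynomial.coeff_zero_eq_eval_zero, binomPoly, Polynomial.eval_mul,
    descPochhammer_ne_zero_eval_zero _ hk, mul_zero]

/-- The sum of `f` over the colourings using exactly the colours below `k`. -/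
def surjSum {n : ℕ} {M : Type*} [AddCommMonoid M] (f : (Fin n → ℕ) → M) (k : ℕ) : M :=
  ∑ σ : Fin n → Fin k with Function.Surjective σ, f fun j => (σ j : ℕ)

theorem surjSum_of_lt {n k : ℕ} {M : Type*} [AddCommMonoid M] (f : (Fin n → ℕ) → M) (h : n < k) :
    surjSum f k = 0 := by
  rw [surjSum, Finset.filter_false_of_mem, Finset.sum_empty]
  intro σ _ hσ
  have := Fintype.card_le_of_surjective σ hσ
  simp at this
  omega

/-- Colourings are grouped by their sets of colours. -/
theorem sum_colourings {n : ℕ} {M : Type*} [AddCommMonoid M] (f : (Fin n → ℕ) → M)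
    (hf : ∀ ω ω' : Fin n → ℕ, (∀ i j, ω i ≤ ω j ↔ ω' i ≤ ω' j) → f ω = f ω') (N : ℕ) :
    ∑ ω : Fin n → Fin N, f (fun j => (ω j : ℕ)) =
      ∑ k ∈ Finset.range (n + 1), N.choose k • surjSum f k := by
  have h1 : ∀ I : Finset (Fin N),
      (∑ ω : Fin n → Fin N with Finset.univ.image ω = I, f fun j => (ω j : ℕ)) =
        surjSum f I.card := by
    intro I
    symm
    -- A colouring with colour set `I` is relabelled by the increasing bijection from `Fin I.card`
    -- to `I`, which keeps the order pattern.
    refine Finset.sum_bij (fun σ _ j => I.orderEmbOfFin rfl (σ j)) ?_ ?_ ?_ ?_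
    · intro σ hσ
      rw [Finset.mem_filter] at hσ ⊢
      refine ⟨Finset.mem_univ _, ?_⟩
      ext x
      rw [Finset.mem_image]
      constructor
      · rintro ⟨j, -, rfl⟩
        exact Finset.orderEmbOfFin_mem _ _ _
      · intro hx
        have : x ∈ Set.range (I.orderEmbOfFin rfl) := by
          rw [Finset.range_orderEmbOfFin]
          exact hx
        obtain ⟨y, rfl⟩ := this
        obtain ⟨j, rfl⟩ := hσ.2 y
        exact ⟨j, Finset.mem_univ _, rfl⟩
    · intro σ _ τ _ h
      funext j
      exact (I.orderEmbOfFin rfl).injective (congrFun h j)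
    · intro ω hω
      have hω := (Finset.mem_filter.1 hω).2
      have hmem : ∀ j, ω j ∈ Set.range (I.orderEmbOfFin rfl) := by
        intro j
        rw [Finset.range_orderEmbOfFin, ← hω]
        exact Finset.mem_image_of_mem _ (Finset.mem_univ j)
      choose σ hσ using hmem
      refine ⟨σ, Finset.mem_filter.2 ⟨Finset.mem_univ _, fun y => ?_⟩, funext hσ⟩
      have : I.orderEmbOfFin rfl y ∈ Finset.univ.image ω := by
        rw [hω]
        exact Finset.orderEmbOfFin_mem _ _ _
      obtain ⟨j, -, hj⟩ := Finset.mem_image.1 this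
      exact ⟨j, (I.orderEmbOfFin rfl).injective ((hσ j).trans hj)⟩
    · intro σ _
      refine hf _ _ fun i j => ?_
      rw [Fin.val_fin_le, Fin.val_fin_le]
      exact ((I.orderEmbOfFin rfl).le_iff_le).symm
  rw [← Finset.sum_fiberwise Finset.univ fun ω => Finset.univ.image ω,
    Finset.sum_congr rfl fun I _ => h1 I, ← Finset.powerset_univ,
    Finset.sum_powerset_apply_card, Finset.card_univ, Fintype.card_fin]
  -- Both sums extend to a common range: binomials vanish for `k > N`, surjections for `k > n`.
  have e1 : ∑ k ∈ Finset.range (N + 1), N.choose k • surjSum f k =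
      ∑ k ∈ Finset.range (N + n + 1), N.choose k • surjSum f k := by
    refine Finset.sum_subset (Finset.range_subset_range.2 (by omega)) fun k _ hk => ?_
    rw [Nat.choose_eq_zero_of_lt (by simpa using hk), zero_smul]
  have e2 : ∑ k ∈ Finset.range (n + 1), N.choose k • surjSum f k =
      ∑ k ∈ Finset.range (N + n + 1), N.choose k • surjSum f k := by
    refine Finset.sum_subset (Finset.range_subset_range.2 (by omega)) fun k _ hk => ?_
    rw [surjSum_of_lt f (by simpa using hk), smul_zero]
  rw [e1, e2]

theorem surjSum_zero {n : ℕ} {M : Type*} [AddCommMonoid M] (f : (Fin n → ℕ) → M) (hn : 1 ≤ n) :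
    surjSum f 0 = 0 := by
  rw [surjSum, Finset.filter_false_of_mem, Finset.sum_empty]
  exact fun σ _ _ => (σ ⟨0, hn⟩).elim0

theorem surjSum_one {n : ℕ} {M : Type*} [AddCommMonoid M] (f : (Fin n → ℕ) → M) (hn : 1 ≤ n) :
    surjSum f 1 = f fun _ => 0 := by
  have h : ∀ σ : Fin n → Fin 1, (fun j => (σ j : ℕ)) = fun _ => 0 := fun σ => by
    funext j; simp
  rw [surjSum, Finset.filter_true_of_mem]
  · simp
  · exact fun σ _ y => ⟨⟨0, hn⟩, Subsingleton.elim _ _⟩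

theorem sum_colourings_eq {n : ℕ} (hn : 1 ≤ n) (f : (Fin n → ℕ) → ℂ)
    (hf : ∀ ω ω' : Fin n → ℕ, (∀ i j, ω i ≤ ω j ↔ ω' i ≤ ω' j) → f ω = f ω') (N : ℕ) :
    ∑ ω : Fin n → Fin N, f (fun j => (ω j : ℕ)) =
      f (fun _ => 0) * N + ∑ k ∈ Finset.Icc 2 n, surjSum f k * (binomPoly k).eval (N : ℂ) := by
  rw [sum_colourings f hf, Finset.range_eq_Ico, Finset.sum_eq_sum_Ico_succ_bot (by omega),
    Finset.sum_eq_sum_Ico_succ_bot (by omega), surjSum_zero f hn, surjSum_one f hn]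
  rw [smul_zero, zero_add, Nat.choose_one_right, nsmul_eq_mul, mul_comm]
  congr 1
  refine Finset.sum_congr rfl fun k _ => ?_
  rw [binomPoly_eval, nsmul_eq_mul, mul_comm]

end Colourings

/-! ### The polynomials of the dot operation -/

section DotPolynomials

theorem nestBlocks_congr {n : ℕ} (χ : Fin n → Side) (V : Finset (Fin n)) {ω ω' : Fin n → ℕ}
    (h : ∀ i j, ω i ≤ ω j ↔ ω' i ≤ ω' j) : nestBlocks χ V ω = nestBlocks χ V ω' := by
  have : nestBlock χ V ω = nestBlock χ V ω' := by
    funext j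
    ext i
    simp only [nestBlock, Finset.mem_filter, h, le_antisymm_iff]
  rw [nestBlocks, nestBlocks, this]

/-- The product of the variables of the nested blocks. -/
def blockMonomial {n : ℕ} (χ : Fin n → Side) (ω : Fin n → ℕ) : MvPolynomial (ProperSub n) ℂ :=
  ∏ V ∈ nestBlocks χ Finset.univ ω,
    -- The default `0` is never met in `momentDotPoly`: with at least two colours every block is
    -- nonempty and proper.
    if h : V.Nonempty ∧ V ≠ Finset.univ then MvPolynomial.X ⟨V, h⟩ else 0

/-- The polynomials `P_χ`. -/
def momentDotPoly : DotPolyFamily := fun n χ =>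
  ∑ k ∈ Finset.Icc 2 n,
    Polynomial.C (surjSum (blockMonomial χ) k) * (binomPoly k).map MvPolynomial.C

theorem momentDotPoly_coeff_zero (n : ℕ) (χ : Fin n → Side) : (momentDotPoly n χ).coeff 0 = 0 := by
  rw [momentDotPoly, Polynomial.finsetSum_coeff]
  refine Finset.sum_eq_zero fun k hk => ?_
  have : k ≠ 0 := by have := (Finset.mem_Icc.1 hk).1; omega
  rw [Polynomial.coeff_C_mul, Polynomial.coeff_map, binomPoly_coeff_zero this, map_zero, mul_zero]

variable {A : Type u} [NonUnitalRing A] [Module ℂ A] [IsScalarTower ℂ A A] [SMulCommClass ℂ A A]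
variable {S : Side → NonUnitalSubalgebra ℂ A} (φ : A →ₗ[ℂ] ℂ)

/-- The moment of the word with the given colours. -/
def colourMoment {n : ℕ} {χ : Fin n → Side} (a : ∀ j, S (χ j)) (ω : Fin n → ℕ) : ℂ :=
  ∏ V ∈ nestBlocks χ Finset.univ ω, subMoment φ a V

theorem eval_blockMonomial {n k : ℕ} (hk : 2 ≤ k) (χ : Fin n → Side) (a : ∀ j, S (χ j))
    {σ : Fin n → Fin k} (hσ : Function.Surjective σ) :
    MvPolynomial.eval (fun V : ProperSub n =>
        moment φ fun j => (restrictTuple (X := fun s => S s) a V.1 j : A))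
      (blockMonomial χ fun j => (σ j : ℕ)) = colourMoment φ a fun j => (σ j : ℕ) := by
  rw [blockMonomial, map_prod]
  refine Finset.prod_congr rfl fun V hV => ?_
  obtain ⟨j, -, rfl⟩ := Finset.mem_image.1 hV
  have h : (nestBlock χ Finset.univ (fun j => (σ j : ℕ)) j).Nonempty ∧
      nestBlock χ Finset.univ (fun j => (σ j : ℕ)) j ≠ Finset.univ := by
    refine ⟨⟨j, mem_nestBlock_self χ (Finset.mem_univ j)⟩, fun h => ?_⟩
    have hall : ∀ i, σ i = σ j := fun i =>
      Fin.ext (Finset.mem_filter.1 (h.symm.subset (Finset.mem_univ i))).2.1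
    obtain ⟨i₀, h0⟩ := hσ ⟨0, by omega⟩
    obtain ⟨i₁, h1⟩ := hσ ⟨1, by omega⟩
    have := (h0.symm.trans ((hall i₀).trans (hall i₁).symm)).trans h1
    simp at this
  rw [dif_pos h, MvPolynomial.eval_X]
  rfl

theorem dotPoly_eq {n : ℕ} (χ : Fin n → Side) (a : ∀ j, S (χ j)) :
    dotPoly momentDotPoly φ χ a =
      Polynomial.C (subMoment φ a Finset.univ) * Polynomial.X +
        ∑ k ∈ Finset.Icc 2 n, Polynomial.C (surjSum (colourMoment φ a) k) * binomPoly k := by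
  rw [dotPoly, moment_eq_subMoment, momentDotPoly, Polynomial.map_sum]
  congr 1
  refine Finset.sum_congr rfl fun k hk => ?_
  rw [Polynomial.map_mul, Polynomial.map_C, Polynomial.map_map, surjSum, map_sum, surjSum,
    Finset.sum_congr rfl fun σ hσ => eval_blockMonomial φ (Finset.mem_Icc.1 hk).1 χ a
      (Finset.mem_filter.1 hσ).2]
  congr 1
  convert Polynomial.map_id
  ext
  simp

theorem colourMoment_zero {n : ℕ} (hn : 1 ≤ n) {χ : Fin n → Side} (a : ∀ j, S (χ j)) :
    colourMoment φ a (fun _ => 0) = subMoment φ a Finset.univ := by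
  rw [colourMoment, nestBlocks_const χ hn, Finset.prod_singleton]

theorem eval_dotPoly {n : ℕ} (hn : 1 ≤ n) (χ : Fin n → Side) (a : ∀ j, S (χ j)) (N : ℕ) :
    (dotPoly momentDotPoly φ χ a).eval (N : ℂ) =
      ∑ ω : Fin n → Fin N, colourMoment φ a fun j => (ω j : ℕ) := by
  rw [sum_colourings_eq hn (colourMoment φ a) fun ω ω' h => by
    rw [colourMoment, nestBlocks_congr χ _ h]; rfl]
  rw [dotPoly_eq, colourMoment_zero φ hn]
  simp [Polynomial.eval_finsetSum]

theorem prod_ofFn_inr {B : Type*} [Ring B] [Algebra ℂ B] {n : ℕ} (x : Fin (n + 1) → B) :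
    (List.ofFn fun j => (Unitization.inr (x j) : Unitization ℂ B)).prod =
      Unitization.inr (List.ofFn x).prod := by
  induction n with
  | zero => simp
  | succ n ih =>
    rw [List.ofFn_succ, List.prod_cons, ih fun j => x j.succ, List.ofFn_succ (f := x),
      List.prod_cons, Unitization.inr_mul]

/-- For `n = 0` the product would be the adjoined unit rather than the unit of `B`. -/
theorem moment_eq_of_unital {B : Type u} [Ring B] [Algebra ℂ B] (Φ : B →ₗ[ℂ] ℂ) {n : ℕ}
    (hn : 1 ≤ n) (x : Fin n → B) : moment Φ x = Φ (List.ofFn x).prod := by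
  obtain ⟨n, rfl⟩ := Nat.exists_eq_add_of_le' hn
  rw [moment, prod_ofFn_inr]
  simp [extend]

/-- A word as a multilinear map of its letters. -/
def wordMap {n : ℕ} (χ : Fin n → Side) (ω : Fin n → ℕ) :
    MultilinearMap ℂ (fun j => S (χ j)) (DotAlg S) :=
  (MultilinearMap.mkPiAlgebraFin ℂ n (DotAlg S)).compLinearMap fun j =>
    (copyHom S (ω j) (χ j) : S (χ j) →ₗ[ℂ] DotAlg S)

theorem wordMap_apply {n : ℕ} {χ : Fin n → Side} (ω : Fin n → ℕ) (a : ∀ j, S (χ j)) :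
    wordMap χ ω a = word ω a := by
  simp only [wordMap, MultilinearMap.compLinearMap_apply, MultilinearMap.mkPiAlgebraFin_apply]
  rfl

/-- In this form multilinearity in the letters is visible, which the product over blocks hides. -/
theorem colourMoment_eq {n : ℕ} {χ : Fin n → Side} (ω : Fin n → ℕ) (a : ∀ j, S (χ j)) :
    colourMoment φ a ω = productFun φ (wordMap χ ω a) := by
  rw [wordMap_apply, productFun_word]
  rfl

/-- The moments of `N.a`. -/
theorem moment_dot {n : ℕ} (hn : 1 ≤ n) (χ : Fin n → Side) (a : ∀ j, S (χ j)) (N : ℕ) :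
    (moment (productFun φ) fun j => (dot S N (a j) : DotAlg S)) =
      (dotPoly momentDotPoly φ χ a).eval (N : ℂ) := by
  rw [moment_eq_of_unital _ hn, eval_dotPoly φ hn]
  have h : (fun j => (dot S N (a j) : DotAlg S)) =
      fun j => ∑ i : Fin N, copy S i (χ j) (a j) := by
    funext j
    simp [dot, Finset.sum_range]
  rw [h, ← MultilinearMap.mkPiAlgebraFin_apply (R := ℂ), MultilinearMap.map_sum, map_sum]
  refine Finset.sum_congr rfl fun ω _ => ?_
  rw [colourMoment_eq, wordMap_apply, MultilinearMap.mkPiAlgebraFin_apply]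
  rfl

/-- The coefficients of `N` are multilinear. -/
theorem isMultilinearFamily_coeff :
    IsMultilinearFamily (S := S) fun _ χ a => (dotPoly momentDotPoly φ χ a).coeff 1 := by
  intro n hn χ
  refine ⟨(productFun φ).compMultilinearMap (wordMap χ fun _ => 0) +
    ∑ k ∈ Finset.Icc 2 n, (binomPoly k).coeff 1 •
      ∑ σ : Fin n → Fin k with Function.Surjective σ,
        (productFun φ).compMultilinearMap (wordMap χ fun j => (σ j : ℕ)), fun a => ?_⟩
  change _ = (dotPoly momentDotPoly φ χ a).coeff 1
  rw [dotPoly_eq, ← colourMoment_zero φ hn]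
  simp only [add_apply, sum_apply, smul_apply,
    LinearMap.compMultilinearMap_apply, ← colourMoment_eq, Polynomial.coeff_add,
    Polynomial.finsetSum_coeff, Polynomial.coeff_C_mul, Polynomial.coeff_X_one, mul_one, surjSum,
    smul_eq_mul]
  congr 1
  exact Finset.sum_congr rfl fun k _ => mul_comm _ _

end DotPolynomials

/-! ### Inversion of the relation between moments and cumulants -/

section Inversion

/-- Iterated restrictions have different index types. Since the increasing enumeration of `U` is
unique, any enumeration gives the same value. -/
theorem family_orderEmb {X : Side → Type u} (F : ∀ (n : ℕ) (χ : Fin n → Side), (∀ j, X (χ j)) → ℂ)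
    {n k : ℕ} (χ : Fin n → Side) (a : ∀ j, X (χ j)) (e : Fin k ↪o Fin n) (U : Finset (Fin n))
    (hU : ∀ i, e i ∈ U) (hk : U.card = k) :
    F k (fun i => χ (e i)) (fun i => a (e i)) = F _ (restrictSide χ U) (restrictTuple a U) := by
  have he := Finset.orderEmbOfFin_unique' hk hU
  subst hk
  subst he
  rfl

theorem card_lt_of_properSub {n : ℕ} (V : ProperSub n) : V.1.card < n := by
  have := Finset.card_lt_card (Finset.ssubset_univ_iff.2 V.2.2)
  simpa using this

/-- The image of a nonempty proper subset of a nonempty proper subset. -/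
def ProperSub.comp {n : ℕ} (V : ProperSub n) (W : ProperSub V.1.card) : ProperSub n :=
  ⟨W.1.map (V.1.orderEmbOfFin rfl).toEmbedding, W.2.1.map, fun h => by
    have h1 : (W.1.map (V.1.orderEmbOfFin rfl).toEmbedding).card = n := by
      rw [h, Finset.card_univ, Fintype.card_fin]
    rw [Finset.card_map] at h1
    have h2 := card_lt_of_properSub W
    have h3 := card_lt_of_properSub V
    omega⟩

theorem restrict_comp {X : Side → Type u}
    (F : ∀ (n : ℕ) (χ : Fin n → Side), (∀ j, X (χ j)) → ℂ) {n : ℕ} (χ : Fin n → Side)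
    (a : ∀ j, X (χ j)) (V : ProperSub n) (W : ProperSub V.1.card) :
    F _ (restrictSide (restrictSide χ V.1) W.1) (restrictTuple (restrictTuple a V.1) W.1) =
      F _ (restrictSide χ (V.comp W).1) (restrictTuple a (V.comp W).1) :=
  family_orderEmb F χ a ((W.1.orderEmbOfFin rfl).trans (V.1.orderEmbOfFin rfl)) (V.comp W).1
    (fun i => Finset.mem_map_of_mem _ (Finset.orderEmbOfFin_mem _ _ i)) (Finset.card_map _)

/-- A triangular polynomial relation between two families can be inverted. -/
theorem exists_inverse_polynomials (R : PolyFamily) :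
    ∃ Q : PolyFamily, ∀ (X : Side → Type u)
      (μ K : ∀ (n : ℕ) (χ : Fin n → Side), (∀ j, X (χ j)) → ℂ),
      (∀ n χ a, K n χ a = μ n χ a +
        MvPolynomial.eval (fun V : ProperSub n =>
          μ _ (restrictSide χ V.1) (restrictTuple a V.1)) (R n χ)) →
      ∀ n χ a, μ n χ a = K n χ a +
        MvPolynomial.eval (fun V : ProperSub n =>
          K _ (restrictSide χ V.1) (restrictTuple a V.1)) (Q n χ) := by
  suffices H : ∀ (n : ℕ) (χ : Fin n → Side), ∃ q : MvPolynomial (ProperSub n) ℂ,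
      ∀ (X : Side → Type u) (μ K : ∀ (n : ℕ) (χ : Fin n → Side), (∀ j, X (χ j)) → ℂ),
      (∀ n χ a, K n χ a = μ n χ a +
        MvPolynomial.eval (fun V : ProperSub n =>
          μ _ (restrictSide χ V.1) (restrictTuple a V.1)) (R n χ)) →
      ∀ a, μ n χ a = K n χ a +
        MvPolynomial.eval (fun V : ProperSub n =>
          K _ (restrictSide χ V.1) (restrictTuple a V.1)) q by
    choose Q hQ using H
    exact ⟨Q, fun X μ K h n χ a => hQ n χ X μ K h a⟩
  intro n
  induction n using Nat.strong_induction_on with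
  | _ n ih =>
    intro χ
    choose q hq using fun V : ProperSub n => ih V.1.card (card_lt_of_properSub V)
      (restrictSide χ V.1)
    -- Each lower `μ_V` is `K_V + q_V` by induction. Substitute this into `R`, with subsets of `V`
    -- renamed as subsets of all positions.
    refine ⟨-MvPolynomial.bind₁ (fun V : ProperSub n =>
      MvPolynomial.X V + MvPolynomial.rename (ProperSub.comp V) (q V)) (R n χ),
      fun X μ K h a => ?_⟩
    have hV : (fun V : ProperSub n => μ _ (restrictSide χ V.1) (restrictTuple a V.1)) =
        fun V : ProperSub n => MvPolynomial.eval (fun V : ProperSub n =>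
          K _ (restrictSide χ V.1) (restrictTuple a V.1))
          (MvPolynomial.X V + MvPolynomial.rename (ProperSub.comp V) (q V)) := by
      funext V
      rw [hq V X μ K h, map_add, MvPolynomial.eval_X, MvPolynomial.eval_rename]
      congr 3
      funext W
      exact restrict_comp K χ a V W
    have hb : ∀ (f : ProperSub n → ℂ) (g : ProperSub n → MvPolynomial (ProperSub n) ℂ) p,
        MvPolynomial.eval f (MvPolynomial.bind₁ g p) =
          MvPolynomial.eval (fun V => MvPolynomial.eval f (g V)) p := fun f g p =>
      MvPolynomial.eval₂Hom_bind₁ (RingHom.id ℂ) f g p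
    rw [h n χ a, map_neg, hb, ← hV]
    ring

end Inversion

/-! ### Associativity of the dot operation -/

section Associativity

theorem nestBlock_eq_of_mem {n : ℕ} (χ : Fin n → Side) (σ : Fin n → ℕ) {i j : Fin n}
    (hij : i ∈ nestBlock χ Finset.univ σ j) :
    nestBlock χ Finset.univ σ i = nestBlock χ Finset.univ σ j := by
  have hsub : ∀ i j, i ∈ nestBlock χ Finset.univ σ j →
      nestBlock χ Finset.univ σ i ⊆ nestBlock χ Finset.univ σ j := by
    intro i j hi l hl
    simp only [nestBlock, Finset.mem_filter, Finset.mem_univ, true_and, forall_const] at *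
    refine ⟨hl.1.trans hi.1, fun k hk => ?_⟩
    rcases chiBetween_cases (l := i) hk with hk | hk
    · exact hi.1 ▸ hl.2 k hk
    · exact hi.2 k hk
  refine (hsub i j hij).antisymm (hsub j i ?_)
  simp only [nestBlock, Finset.mem_filter, Finset.mem_univ, true_and, forall_const] at *
  exact ⟨hij.1.symm, fun k hk => hij.1 ▸ hij.2 k (chiBetween_symm hk)⟩

/-- Nested blocks of nested blocks are nested blocks for the lexicographic colouring. -/
theorem nestBlocks_lex {n : ℕ} (χ : Fin n → Side) {N : ℕ} (σ ω : Fin n → ℕ) (hω : ∀ j, ω j < N) :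
    nestBlocks χ Finset.univ (fun j => ω j + N * σ j) =
      (nestBlocks χ Finset.univ σ).biUnion fun V => nestBlocks χ V ω := by
  have hle : ∀ i j, ω i + N * σ i ≤ ω j + N * σ j ↔ σ i < σ j ∨ (σ i = σ j ∧ ω i ≤ ω j) := by
    intro i j
    have hi := hω i
    have hj := hω j
    rcases lt_trichotomy (σ i) (σ j) with h | h | h
    · have : N * (σ i + 1) ≤ N * σ j := Nat.mul_le_mul_left N h
      rw [mul_add] at this
      omega
    · rw [h]; omega
    · have : N * (σ j + 1) ≤ N * σ i := Nat.mul_le_mul_left N h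
      rw [mul_add] at this
      omega
  have hblock : ∀ j, nestBlock χ Finset.univ (fun j => ω j + N * σ j) j =
      nestBlock χ (nestBlock χ Finset.univ σ j) ω j := by
    intro j
    ext i
    simp only [nestBlock, Finset.mem_filter, Finset.mem_univ, true_and, forall_const,
      le_antisymm_iff (a := ω i + N * σ i), hle, and_imp]
    constructor
    · rintro ⟨⟨h1, h2⟩, h3⟩
      have hσ : σ i = σ j := by omega
      refine ⟨⟨hσ, fun k hk => ?_⟩, by omega, fun k hk _ hb => ?_⟩
      · rcases h3 k hk with h | h
        · exact h.le
        · exact h.1.le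
      · rcases h3 k hb with h | h
        · omega
        · exact h.2
    · rintro ⟨⟨h1, h2⟩, h3, h4⟩
      refine ⟨⟨by omega, by omega⟩, fun k hk => ?_⟩
      rcases (h2 k hk).lt_or_eq with h | h
      · exact Or.inl h
      -- Here `k` lies in the `σ`-block of `j`: whatever lies between `k` and `j` lies between `i`
      -- and `j`. In the two mixed cases `k = j`.
      · refine Or.inr ⟨h, h4 k h.symm (fun l hl => h2 l ?_) hk⟩
        rcases hk with hk | hk <;> rcases hl with hl | hl
        · exact Or.inl ⟨trans_of _ hk.1 hl.1, hl.2⟩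
        · have hkj := antisymm_of (chiLE χ) hk.2 (trans_of _ hl.1 hl.2)
          subst hkj
          have hlk := antisymm_of (chiLE χ) hl.2 hl.1
          subst hlk
          exact Or.inl hk
        · have hkj := antisymm_of (chiLE χ) hk.1 (trans_of _ hl.1 hl.2)
          subst hkj
          have hlk := antisymm_of (chiLE χ) hl.2 hl.1
          subst hlk
          exact Or.inr hk
        · exact Or.inr ⟨hl.1, trans_of _ hl.2 hk.2⟩
  ext U
  simp only [nestBlocks, Finset.mem_biUnion, Finset.mem_image, Finset.mem_univ, true_and]
  constructor
  · rintro ⟨j, rfl⟩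
    exact ⟨_, ⟨j, rfl⟩, j, mem_nestBlock_self χ (Finset.mem_univ j), (hblock j).symm⟩
  · rintro ⟨_, ⟨j, rfl⟩, i, hi, rfl⟩
    exact ⟨i, by rw [hblock, nestBlock_eq_of_mem χ σ hi]⟩

theorem pairwiseDisjoint_nestBlocks {n : ℕ} (χ : Fin n → Side) (σ ω : Fin n → ℕ) :
    Set.PairwiseDisjoint (nestBlocks χ Finset.univ σ : Set (Finset (Fin n)))
      fun V => nestBlocks χ V ω := by
  intro V hV V' hV' hne
  refine Finset.disjoint_left.2 fun U hU hU' => hne ?_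
  obtain ⟨j, -, rfl⟩ := Finset.mem_image.1 hV
  obtain ⟨j', -, rfl⟩ := Finset.mem_image.1 hV'
  obtain ⟨i, hi, rfl⟩ := Finset.mem_image.1 hU
  obtain ⟨i', hi', h⟩ := Finset.mem_image.1 hU'
  have hmem := mem_nestBlock_self χ (ω := ω) hi
  rw [← h] at hmem
  rw [← nestBlock_eq_of_mem χ σ hi,
    ← nestBlock_eq_of_mem χ σ (Finset.mem_filter.1 hmem).1]

variable {A : Type u} [NonUnitalRing A] [Module ℂ A] [IsScalarTower ℂ A A] [SMulCommClass ℂ A A]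
variable {S : Side → NonUnitalSubalgebra ℂ A} (φ : A →ₗ[ℂ] ℂ)

/-- A copy as an element of the enlarged subalgebra of its side. -/
def dotCopy (i : ℕ) {s : Side} (a : S s) : dotSide S s :=
  ⟨copy S i s a, NonUnitalAlgebra.subset_adjoin ℂ ⟨i, a, rfl⟩⟩

theorem dot_eq_sum (N : ℕ) {s : Side} (a : S s) : dot S N a = ∑ i : Fin N, dotCopy (i : ℕ) a := by
  apply Subtype.ext
  rw [AddSubmonoidClass.coe_finsetSum]
  simp [dot, dotCopy, Finset.sum_range]

theorem subMoment_dotCopy {n : ℕ} {χ : Fin n → Side} (a : ∀ j, S (χ j)) (ω : Fin n → ℕ)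
    {V : Finset (Fin n)} (hV : V.Nonempty) :
    subMoment (productFun φ) (fun j => dotCopy (ω j) (a j)) V =
      ∏ U ∈ nestBlocks χ V ω, subMoment φ a U := by
  rw [← productFun_subWord, subWord, ← prod_ofFn_orderEmbOfFin
    (fun j => copy S (ω j) (χ j) (a j)), ← moment_eq_of_unital (productFun φ) hV.card_pos]
  rfl

theorem colourMoment_dotCopy {n : ℕ} {χ : Fin n → Side} (a : ∀ j, S (χ j)) {N : ℕ}
    (σ ω : Fin n → ℕ) (hω : ∀ j, ω j < N) :
    colourMoment (productFun φ) (fun j => dotCopy (ω j) (a j)) σ =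
      colourMoment φ a fun j => ω j + N * σ j := by
  rw [colourMoment, colourMoment, nestBlocks_lex χ σ ω hω,
    Finset.prod_biUnion (pairwiseDisjoint_nestBlocks χ σ ω)]
  refine Finset.prod_congr rfl fun V hV => subMoment_dotCopy φ a ω ?_
  obtain ⟨j, hj, rfl⟩ := Finset.mem_image.1 hV
  exact ⟨j, mem_nestBlock_self χ hj⟩

/-- An outer colour `σ < M` and an inner colour `ω < N` combine to `ω + N σ < M N`, bijectively:
`M.(N.a)` and `(MN).a` have the same moments. -/
theorem eval_dotPoly_dot {n : ℕ} (hn : 1 ≤ n) (χ : Fin n → Side) (a : ∀ j, S (χ j)) (M N : ℕ) :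
    (dotPoly momentDotPoly (productFun φ) χ fun j => dot S N (a j)).eval (M : ℂ) =
      (dotPoly momentDotPoly φ χ a).eval ((M * N : ℕ) : ℂ) := by
  have h : (fun j => dot S N (a j)) = fun j => ∑ i : Fin N, dotCopy (i : ℕ) (a j) := by
    funext j
    exact dot_eq_sum N (a j)
  have h1 : ∀ σ : Fin n → Fin M,
      colourMoment (productFun φ) (fun j => dot S N (a j)) (fun j => (σ j : ℕ)) =
        ∑ ω : Fin n → Fin N, colourMoment φ a fun j => (ω j : ℕ) + N * (σ j : ℕ) := by
    intro σ
    rw [colourMoment_eq, h, MultilinearMap.map_sum, map_sum]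
    refine Finset.sum_congr rfl fun ω _ => ?_
    rw [← colourMoment_eq]
    exact colourMoment_dotCopy φ a (fun j => (σ j : ℕ)) (fun j => (ω j : ℕ)) fun j => (ω j).2
  rw [eval_dotPoly _ hn, eval_dotPoly _ hn, Finset.sum_congr rfl fun σ _ => h1 σ,
    ← Fintype.sum_prod_type']
  refine Fintype.sum_equiv ((Equiv.arrowProdEquivProdArrow (Fin n) (fun _ => Fin M)
    (fun _ => Fin N)).symm.trans (Equiv.arrowCongr (Equiv.refl _) finProdFinEquiv)) _ _
    fun x => rfl

/-- The coefficients of `N` are extensive. -/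
theorem coeff_dotPoly_dot {n : ℕ} (hn : 1 ≤ n) (χ : Fin n → Side) (a : ∀ j, S (χ j)) (N : ℕ) :
    (dotPoly momentDotPoly (productFun φ) χ fun j => dot S N (a j)).coeff 1 =
      N * (dotPoly momentDotPoly φ χ a).coeff 1 := by
  have h : (dotPoly momentDotPoly (productFun φ) χ fun j => dot S N (a j)) =
      (dotPoly momentDotPoly φ χ a).comp (Polynomial.C (N : ℂ) * Polynomial.X) := by
    refine Polynomial.eq_of_infinite_eval_eq _ _
      ((Set.infinite_range_of_injective (Nat.cast_injective (R := ℂ))).mono ?_)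
    rintro _ ⟨M, rfl⟩
    rw [Set.mem_ofPred_eq, eval_dotPoly_dot φ hn]
    simp [mul_comm]
  rw [h, Polynomial.comp_C_mul_X_coeff, pow_one, mul_comm]

end Associativity

/-! ### Existence and uniqueness of cumulants -/

section Cumulants

/-- `Q` inverts the relation `K = μ + R(μ)` with `R` the coefficient of `N` in `P`. It does not
depend on the algebra, so it also serves the enlarged space. -/
theorem exists_cumulantPoly : ∃ Q : PolyFamily,
    ∀ (A : Type u) [NonUnitalRing A] [Module ℂ A] [IsScalarTower ℂ A A] [SMulCommClass ℂ A A]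
      (φ : A →ₗ[ℂ] ℂ) (S : Side → NonUnitalSubalgebra ℂ A),
      MomentRelation Q (S := S) φ fun _ χ a => (dotPoly momentDotPoly φ χ a).coeff 1 := by
  obtain ⟨Q, hQ⟩ := exists_inverse_polynomials.{u} fun n χ => (momentDotPoly n χ).coeff 1
  refine ⟨Q, fun A _ _ _ _ φ S n _ χ a => ?_⟩
  refine hQ (fun s => S s) (fun n χ a => moment φ fun j => (a j : A))
    (fun _ χ a => (dotPoly momentDotPoly φ χ a).coeff 1) (fun n χ a => ?_) n χ a
  rw [dotPoly, Polynomial.coeff_add, Polynomial.coeff_C_mul, Polynomial.coeff_X_one, mul_one,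
    Polynomial.coeff_map]

variable {A : Type u} [NonUnitalRing A] [Module ℂ A] [IsScalarTower ℂ A A] [SMulCommClass ℂ A A]
variable {S : Side → NonUnitalSubalgebra ℂ A} (φ : A →ₗ[ℂ] ℂ)

theorem moment_dot_smul {n : ℕ} (hn : 1 ≤ n) (χ : Fin n → Side) (a : ∀ j, S (χ j)) (N : ℕ)
    (t : ℂ) (Φ : DotAlg S →ₗ[ℂ] ℂ) :
    (moment Φ fun j => (dot S N (t • a j) : DotAlg S)) =
      t ^ n * moment Φ fun j => (dot S N (a j) : DotAlg S) := by
  have h : ∀ j, (dot S N (t • a j) : DotAlg S) = t • (dot S N (a j) : DotAlg S) := by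
    intro j
    simp only [dot, Finset.smul_sum]
    refine Finset.sum_congr rfl fun i _ => ?_
    rw [← copyHom_apply, ← copyHom_apply, map_smul]
  rw [moment_eq_of_unital Φ hn, moment_eq_of_unital Φ hn]
  simp only [h]
  rw [← MultilinearMap.mkPiAlgebraFin_apply (R := ℂ), MultilinearMap.map_smul_univ,
    MultilinearMap.mkPiAlgebraFin_apply, map_smul]
  simp

omit [IsScalarTower ℂ A A] [SMulCommClass ℂ A A] in
theorem IsMultilinearFamily.map_smul {K : FunctionalFamily S} (hK : IsMultilinearFamily K) {n : ℕ}
    (hn : 1 ≤ n) (χ : Fin n → Side) (a : ∀ j, S (χ j)) (t : ℂ) :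
    K n χ (fun j => t • a j) = t ^ n * K n χ a := by
  obtain ⟨f, hf⟩ := hK n hn χ
  rw [← hf, ← hf, MultilinearMap.map_smul_univ]
  simp

/-- Only the part of weight `n` of the polynomial of a family of cumulants contributes. -/
theorem eval_eq_of_homogeneous {n : ℕ} (q : MvPolynomial (ProperSub n) ℂ) (κ : ProperSub n → ℂ)
    (N v : ℂ) (h : ∀ t : ℂ, MvPolynomial.eval (fun V => N * (t ^ V.1.card * κ V)) q = t ^ n * v) :
    v = ∑ d ∈ q.support with ∑ V, V.1.card * d V = n,
      q.coeff d * (∏ V, κ V ^ d V) * N ^ (∑ V, d V) := by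
  -- Both sides are polynomials in `t`; the claim is the equality of their coefficients at `t ^ n`.
  have hpoly : (∑ d ∈ q.support, Polynomial.C (q.coeff d * (∏ V, κ V ^ d V) * N ^ (∑ V, d V)) *
      Polynomial.X ^ (∑ V : ProperSub n, V.1.card * d V)) =
      Polynomial.C v * Polynomial.X ^ n := by
    refine Polynomial.funext fun t => ?_
    have := h t
    rw [MvPolynomial.eval_eq'] at this
    rw [Polynomial.eval_finsetSum]
    simp only [Polynomial.eval_mul, Polynomial.eval_C, Polynomial.eval_pow, Polynomial.eval_X]
    rw [mul_comm v, ← this]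
    refine Finset.sum_congr rfl fun d _ => ?_
    simp only [mul_pow, Finset.prod_mul_distrib, Finset.prod_pow_eq_pow_sum, ← pow_mul]
    ring
  have := congrArg (fun p => p.coeff n) hpoly
  simp only [Polynomial.finsetSum_coeff, Polynomial.coeff_C_mul, Polynomial.coeff_X_pow, if_true,
    mul_one] at this
  rw [← this, Finset.sum_filter]
  refine Finset.sum_congr rfl fun d _ => ?_
  by_cases hd : ∑ V : ProperSub n, V.1.card * d V = n
  · simp [hd]
  · simp [hd, Ne.symm hd]

/-- A monomial of degree one is a single variable, of weight `|V| < n`. This excludes any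
contribution linear in `N`. -/
theorem weight_ne {n : ℕ} (hn : 1 ≤ n) {d : ProperSub n → ℕ} (h : ∑ V, d V = 1) :
    ∑ V : ProperSub n, V.1.card * d V ≠ n := by
  have : ∑ V : ProperSub n, V.1.card * d V ≤ ∑ V : ProperSub n, (n - 1) * d V :=
    Finset.sum_le_sum fun V _ => Nat.mul_le_mul_right _ (by
      have := card_lt_of_properSub V
      omega)
  rw [← Finset.mul_sum, h, mul_one] at this
  omega

/-- Uniqueness of cumulants. -/
theorem IsBiMonotonicCumulants.eq_coeff {Q : PolyFamily} {K : FunctionalFamily S}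
    (h : IsBiMonotonicCumulants Q S φ (productFun φ) K) {n : ℕ} (hn : 1 ≤ n) (χ : Fin n → Side)
    (a : ∀ j, S (χ j)) : K n χ a = (dotPoly momentDotPoly φ χ a).coeff 1 := by
  obtain ⟨Kd, -, hrel, hext⟩ := h.extensive
  let κ : ProperSub n → ℂ := fun V =>
    K _ (restrictSide χ V.1) (restrictTuple (X := fun s => S s) a V.1)
  let v : ℕ → ℂ := fun N => (dotPoly momentDotPoly φ χ a).eval (N : ℂ) - N * K n χ a
  have hhom : ∀ N : ℕ, 1 ≤ N → ∀ t : ℂ,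
      MvPolynomial.eval (fun V => (N : ℂ) * (t ^ V.1.card * κ V)) (Q n χ) = t ^ n * v N := by
    intro N hN t
    have h1 := hrel n hn χ fun j => dot S N (t • a j)
    have h2 : (fun V : ProperSub n => Kd _ (restrictSide χ V.1)
        (restrictTuple (X := fun s => dotSide S s) (fun j => dot S N (t • a j)) V.1)) =
        fun V => (N : ℂ) * (t ^ V.1.card * κ V) := by
      funext V
      have hV : 1 ≤ V.1.card := V.2.1.card_pos
      rw [← h.multilinear.map_smul hV, ← hext _ hV _ _ N hN]
      rfl
    rw [moment_dot_smul hn, moment_dot φ hn, hext n hn χ _ N hN, h.multilinear.map_smul hn, h2] at h1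
    simp only [v]
    rw [mul_sub, h1]
    ring
  let p : Polynomial ℂ := ∑ d ∈ (Q n χ).support with ∑ V, V.1.card * d V = n,
    Polynomial.C ((Q n χ).coeff d * (∏ V, κ V ^ d V)) * Polynomial.X ^ (∑ V, d V)
  have hp : dotPoly momentDotPoly φ χ a = Polynomial.C (K n χ a) * Polynomial.X + p := by
    refine Polynomial.eq_of_infinite_eval_eq _ _ ((Set.infinite_range_of_injective
      -- Extensivity is available only for `N ≥ 1`, hence the shift; infinitely many values still
      -- suffice.
      (f := fun N : ℕ => ((N + 1 : ℕ) : ℂ)) fun M N h => by simpa using h).mono ?_)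
    rintro _ ⟨N, rfl⟩
    have := eval_eq_of_homogeneous (Q n χ) κ _ (v (N + 1)) (hhom (N + 1) (Nat.le_add_left 1 N))
    simp only [v, sub_eq_iff_eq_add'] at this
    rw [Set.mem_ofPred_eq, this, Polynomial.eval_add, Polynomial.eval_finsetSum]
    simp only [Polynomial.eval_mul, Polynomial.eval_C, Polynomial.eval_pow, Polynomial.eval_X]
    rw [mul_comm (K n χ a)]
  rw [hp, Polynomial.coeff_add, Polynomial.coeff_C_mul, Polynomial.coeff_X_one, mul_one,
    Polynomial.finsetSum_coeff, Finset.sum_eq_zero, add_zero]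
  intro d hd
  rw [Polynomial.coeff_C_mul, Polynomial.coeff_X_pow, if_neg, mul_zero]
  exact fun h1 => weight_ne hn h1.symm (Finset.mem_filter.1 hd).2

end Cumulants

end BiMonotonic

end

theorem mainTheorem5 :
    ∃ (P : BiMonotonic.DotPolyFamily) (Q : BiMonotonic.PolyFamily),
      (∀ (n : ℕ) (χ : Fin n → BiMonotonic.Side), (P n χ).coeff 0 = 0) ∧
      ∀ (A : Type u) [NonUnitalRing A] [Module ℂ A] [IsScalarTower ℂ A A] [SMulCommClass ℂ A A]
        (φ : A →ₗ[ℂ] ℂ) (S : BiMonotonic.Side → NonUnitalSubalgebra ℂ A),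
        (∃! Φ : BiMonotonic.DotAlg S →ₗ[ℂ] ℂ, BiMonotonic.IsBiMonotonicProduct S φ Φ) ∧
        ∀ Φ : BiMonotonic.DotAlg S →ₗ[ℂ] ℂ, BiMonotonic.IsBiMonotonicProduct S φ Φ →
          (∀ n : ℕ, 1 ≤ n → ∀ (χ : Fin n → BiMonotonic.Side) (a : ∀ j, S (χ j)) (N : ℕ), 1 ≤ N →
            (BiMonotonic.moment Φ
                fun j => (BiMonotonic.dot S N (a j) : BiMonotonic.DotAlg S)) =
              (BiMonotonic.dotPoly P φ χ a).eval (N : ℂ)) ∧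
          BiMonotonic.IsBiMonotonicCumulants Q S φ Φ
            (fun _ χ a => (BiMonotonic.dotPoly P φ χ a).coeff 1) ∧
          ∀ (Q' : BiMonotonic.PolyFamily) (K' : BiMonotonic.FunctionalFamily S),
            BiMonotonic.IsBiMonotonicCumulants Q' S φ Φ K' →
              ∀ n : ℕ, 1 ≤ n → ∀ (χ : Fin n → BiMonotonic.Side) (a : ∀ j, S (χ j)),
                K' n χ a = (BiMonotonic.dotPoly P φ χ a).coeff 1 := by
  obtain ⟨Q, hQ⟩ := BiMonotonic.exists_cumulantPoly.{u}
  refine ⟨BiMonotonic.momentDotPoly, Q, BiMonotonic.momentDotPoly_coeff_zero, ?_⟩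
  intro A _ _ _ _ φ S
  have hφ := BiMonotonic.productFun_isBiMonotonicProduct (S := S) φ
  refine ⟨⟨BiMonotonic.productFun φ, hφ, fun Φ h => h.unique hφ⟩, fun Φ h => ?_⟩
  obtain rfl := h.unique hφ
  refine ⟨fun n hn χ a N _ => BiMonotonic.moment_dot φ hn χ a N, ⟨?_, hQ A φ S, ?_⟩,
    fun Q' K' hK n hn χ a => hK.eq_coeff φ hn χ a⟩
  · exact BiMonotonic.isMultilinearFamily_coeff φ
  · exact ⟨fun _ χ a => (BiMonotonic.dotPoly BiMonotonic.momentDotPoly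
        (BiMonotonic.productFun φ) χ a).coeff 1,
      BiMonotonic.isMultilinearFamily_coeff _, hQ _ _ _,
      fun n hn χ a N _ => BiMonotonic.coeff_dotPoly_dot φ hn χ a N⟩
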